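/- Let $d\in\{2,3\}$, let $D\subset\mathbb R^d$ be a bounded open set with Lipschitz boundary and outward unit normal $\vec n$, let $T\in\mathbb R$ and $\alpha>0$, let $P$ be a real-valued function on $\mathbb R^2$ (the equation of state), and let $\vec\Omega$ be a time-independent field on $\mathbb R^d$ with values in $\mathbb R^{3}$ if $d=3$ and in $\mathbb R$ if $d=2$, where for $d=2$ one sets $\vec m\times\vec\Omega:=(m_2,-m_1)^{\top}\,\Omega$. Let $\rho,\mathcal E,\varphi$ be real-valued and $\vec m$ an $\mathbb R^d$-valued function on $(0,T)\times\overline D$ with $\rho>0$, and put $$p:=P\Big(\rho,\ \frac{\mathcal E}{\rho}-\frac{|\vec m|^2}{2\rho^2}\Big).$$ Assume that $\rho,\vec m,\mathcal E,p$ are of class $C^1$ and $\varphi$ is of class $C^3$ on $(0,T)\times\overline D$ (up to the boundary of $D$), and that on $(0,T)\times D$ the magnetic Euler–Poisson equations hold: $$\begin{aligned} \partial_t\rho+\nabla\cdot\vec m&=0,\\ \partial_t\vec m+\nabla\cdot\big(\rho^{-1}\vec m\vec m^{\top}+\mathbb I\,p\big)&=-\rho\nabla\varphi+\vec m\times\vec\Omega,\\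 \partial_t\mathcal E+\nabla\cdot\big(\rho^{-1}\vec m(\mathcal E+p)\big)&=-\vec m\cdot\nabla\varphi,\\ \partial_t(-\Delta\varphi)&=-\alpha\,\nabla\cdot\vec m. \end{aligned}$$ Then for every $t\in(0,T)$ both integrals below are integrals of integrable functions, the function $s\mapsto\int_D\big(\mathcal E+\frac1{2\alpha}|\nabla\varphi|^2\big)(s,x)\,dx$ is differentiable at $t$, and $$\frac{d}{dt}\int_D\Big(\mathcal E+\frac1{2\alpha}|\nabla\varphi|^2\Big)\,dx+\int_{\partial D}\Big\{\rho^{-1}\vec m\,(\mathcal E+p)+\varphi\big(\vec m-\alpha^{-1}\partial_t\nabla\varphi\big)\Big\}\cdot\vec n\;do_x=0,$$ where $do_x$ is the $(d-1)$-dimensional surface measure on $\partial D$. -/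

import Mathlib

open Set Filter Topology MeasureTheory
open scoped NNReal

noncomputable section

namespace MagneticEulerPoisson

/-- Euclidean space `ℝᵈ`. -/
abbrev Vec (d : ℕ) : Type := EuclideanSpace ℝ (Fin d)

/-! ### Lipschitz domains, outward normal, surface measure -/

/-- A bounded open subset of `ℝᵈ` with Lipschitz boundary: near each boundary point, in suitable
orthonormal coordinates `(x', x_d)`, it is the region strictly above the graph of a Lipschitz
function `γ` of `x'`. -/
structure IsLipschitzDomain {d : ℕ} (D : Set (Vec d)) : Prop where
  isOpen : IsOpen D
  isBounded : Bornology.IsBounded D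
  exists_graph : ∀ x₀ ∈ frontier D, ∃ (U : Set (Vec d))
    (e : Vec d ≃ₗᵢ[ℝ] WithLp 2 (Vec (d - 1) × ℝ)) (γ : Vec (d - 1) → ℝ) (K : ℝ≥0),
      IsOpen U ∧ x₀ ∈ U ∧ LipschitzWith K γ ∧
        ∀ x ∈ U, x ∈ D ↔ γ (e x).fst < (e x).snd

/-- `ν` is the outward unit normal to `D` at `x`: to first order at `x`, the set `D` is the half
space `{y | ⟪y - x, ν⟫ < 0}`. -/
structure IsOutwardNormal {d : ℕ} (D : Set (Vec d)) (x ν : Vec d) : Prop where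
  norm_eq_one : ‖ν‖ = 1
  inside : ∀ ε > 0, ∀ᶠ y in 𝓝 x, y ∈ D → inner ℝ (y - x) ν ≤ ε * ‖y - x‖
  outside : ∀ ε > 0, ∀ᶠ y in 𝓝 x, y ∉ D → -(ε * ‖y - x‖) ≤ inner ℝ (y - x) ν

open scoped Classical in
/-- The outward unit normal field of `D`, where it exists (there is at most one outward unit normal
at each point, and for a Lipschitz domain there is one at almost every boundary point);
`0` elsewhere. -/
def outwardNormal {d : ℕ} (D : Set (Vec d)) (x : Vec d) : Vec d :=
  if h : ∃ ν, IsOutwardNormal D x ν then h.choose else 0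

/-- Along a direction `w` with `⟪w, ν⟫ < 0`, points near `x` belong to `D`. -/
theorem IsOutwardNormal.inner_nonpos {d : ℕ} {D : Set (Vec d)} {x ν ν' : Vec d}
    (h : IsOutwardNormal D x ν) (h' : IsOutwardNormal D x ν') {w : Vec d}
    (hw : inner ℝ w ν < 0) : inner ℝ w ν' ≤ 0 := by
  have hw0 : 0 < ‖w‖ := by
    rw [norm_pos_iff]
    rintro rfl
    simp at hw
  have hlim : Tendsto (fun s : ℝ => x + s • w) (𝓝[>] 0) (𝓝 x) := by
    have : Continuous (fun s : ℝ => x + s • w) := by fun_prop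
    have h2 := this.tendsto 0
    simp only [zero_smul, add_zero] at h2
    exact h2.mono_left nhdsWithin_le_nhds
  refine le_of_forall_pos_le_add fun δ hδ => ?_
  have h1 := hlim.eventually (h.outside (-(inner ℝ w ν) / (2 * ‖w‖)) (by
    apply div_pos <;> linarith))
  have h2 := hlim.eventually (h'.inside (δ / ‖w‖) (by positivity))
  obtain ⟨s, hs1, hs2, hs⟩ := (h1.and (h2.and self_mem_nhdsWithin)).exists
  have hs : 0 < s := hs
  simp only [add_sub_cancel_left, norm_smul, Real.norm_eq_abs, abs_of_pos hs,
    real_inner_smul_left] at hs1 hs2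
  have hin : x + s • w ∈ D := by
    by_contra hc
    have := hs1 hc
    have e1 : -(inner ℝ w ν) / (2 * ‖w‖) * (s * ‖w‖) = -(s * inner ℝ w ν) / 2 := by
      field_simp
    rw [e1] at this
    nlinarith
  have := hs2 hin
  have e2 : δ / ‖w‖ * (s * ‖w‖) = s * δ := by field_simp
  rw [e2] at this
  have := le_of_mul_le_mul_left this hs
  linarith

/-- The outward unit normal at a point is unique. -/
theorem IsOutwardNormal.unique {d : ℕ} {D : Set (Vec d)} {x ν ν' : Vec d}
    (h : IsOutwardNormal D x ν) (h' : IsOutwardNormal D x ν') : ν = ν' := by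
  by_contra hne
  have hlt : inner ℝ ν ν' < 1 := by
    refine lt_of_le_of_ne ?_ ?_
    · simpa [h.norm_eq_one, h'.norm_eq_one] using real_inner_le_norm ν ν'
    · intro hc
      exact hne ((inner_eq_one_iff_of_norm_eq_one h.norm_eq_one h'.norm_eq_one).1 hc)
  have a1 : inner ℝ ν ν = (1 : ℝ) := by rw [real_inner_self_eq_norm_sq, h.norm_eq_one]; norm_num
  have a2 : inner ℝ ν' ν' = (1 : ℝ) := by rw [real_inner_self_eq_norm_sq, h'.norm_eq_one]; norm_num
  have := h.inner_nonpos h' (w := ν' - ν) (by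
    rw [inner_sub_left, a1, real_inner_comm]; linarith)
  rw [inner_sub_left, a2] at this
  linarith

/-- Surface measure on `∂D`: the `(d-1)`-dimensional Hausdorff measure, normalised to agree with
Lebesgue measure on hyperplanes, restricted to `∂D`. -/
def surfaceMeasure {d : ℕ} (D : Set (Vec d)) : Measure (Vec d) :=
  (Measure.euclideanHausdorffMeasure (d - 1)).restrict (frontier D)

/-! ### Differential operators and the magnetic force -/

/-- Divergence `∑ⱼ ∂ⱼFⱼ` of a vector field. -/
def divergence {d : ℕ} (F : Vec d → Vec d) (x : Vec d) : ℝ :=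
  ∑ j, fderiv ℝ (fun y => F y j) x (EuclideanSpace.single j 1)

/-- Row-wise divergence of a matrix field, `(∇ · A)ᵢ = ∑ⱼ ∂ⱼAᵢⱼ`. -/
def tensorDivergence {d : ℕ} (A : Vec d → Matrix (Fin d) (Fin d) ℝ) (x : Vec d) : Vec d :=
  WithLp.toLp 2 fun i => ∑ j, fderiv ℝ (fun y => A y i j) x (EuclideanSpace.single j 1)

/-- The number of components of the magnetic field: `1` (transverse) in the plane, `3` in space. -/
def magneticDim : ℕ → ℕ
  | 2 => 1
  | 3 => 3
  | _ => 0

/-- `v × B`: the usual cross product in `ℝ³`, and `(v₂ B, -v₁ B)` in `ℝ²`. -/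
def magneticCross : (d : ℕ) → Vec d → Vec (magneticDim d) → Vec d
  | 2, v, B => !₂[v 1 * B (0 : Fin 1), -(v 0 * B (0 : Fin 1))]
  | 3, v, B => WithLp.toLp 2 (crossProduct v.ofLp (WithLp.ofLp (V := Fin 3 → ℝ) B))
  | _, _, _ => 0

/-! ### The system -/

/-- Specific internal energy `e(u) = ℰ/ρ - |m|²/(2ρ²)` of a state `u = (ρ, m, ℰ)`. -/
def internalEnergy {d : ℕ} (ρ : ℝ) (m : Vec d) (E : ℝ) : ℝ :=
  E / ρ - ‖m‖ ^ 2 / (2 * ρ ^ 2)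

/-- Pressure `p(u) = P(ρ, e(u))` given by an equation of state `P`. -/
def pressure {d : ℕ} (P : ℝ → ℝ → ℝ) (ρ : ℝ) (m : Vec d) (E : ℝ) : ℝ :=
  P ρ (internalEnergy ρ m E)

/-- The magnetic Euler–Poisson equations in `D` for times in `(0, T)`, with coupling constant `α`,
equation of state `P` and static rescaled magnetic field `Ω`. Fields are written as functions of
time and position. -/
structure SolvesEquations {d : ℕ} (D : Set (Vec d)) (T α : ℝ) (P : ℝ → ℝ → ℝ)
    (Ω : Vec d → Vec (magneticDim d)) (ρ : ℝ → Vec d → ℝ) (m : ℝ → Vec d → Vec d)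
    (E : ℝ → Vec d → ℝ) (φ : ℝ → Vec d → ℝ) : Prop where
  /-- `∂ₜρ + ∇·m = 0` -/
  mass : ∀ t ∈ Ioo 0 T, ∀ x ∈ D,
    deriv (fun s => ρ s x) t + divergence (m t) x = 0
  /-- `∂ₜm + ∇·(ρ⁻¹ m mᵀ + I p) = -ρ∇φ + m × Ω` -/
  momentum : ∀ t ∈ Ioo 0 T, ∀ x ∈ D,
    deriv (fun s => m s x) t
      + tensorDivergence (fun y => (ρ t y)⁻¹ • Matrix.vecMulVec (m t y).ofLp (m t y).ofLp
          + pressure P (ρ t y) (m t y) (E t y) • (1 : Matrix (Fin d) (Fin d) ℝ)) x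
      = -(ρ t x • gradient (φ t) x) + magneticCross d (m t x) (Ω x)
  /-- `∂ₜℰ + ∇·(ρ⁻¹ m (ℰ + p)) = -m·∇φ` -/
  energy : ∀ t ∈ Ioo 0 T, ∀ x ∈ D,
    deriv (fun s => E s x) t
      + divergence (fun y => ((ρ t y)⁻¹ * (E t y + pressure P (ρ t y) (m t y) (E t y))) • m t y) x
      = -inner ℝ (m t x) (gradient (φ t) x)
  /-- `∂ₜ(-Δφ) = -α ∇·m` -/
  potential : ∀ t ∈ Ioo 0 T, ∀ x ∈ D,
    deriv (fun s => -Laplacian.laplacian (φ s) x) t = -(α * divergence (m t) x)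

/-- Regularity of a smooth solution, up to the boundary in space: positive density, `ρ, m, ℰ, p` of
class `C¹` and `φ` of class `C³` on `(0, T) × closure D`. -/
structure IsSmooth {d : ℕ} (D : Set (Vec d)) (T : ℝ) (P : ℝ → ℝ → ℝ)
    (ρ : ℝ → Vec d → ℝ) (m : ℝ → Vec d → Vec d)
    (E : ℝ → Vec d → ℝ) (φ : ℝ → Vec d → ℝ) : Prop where
  density_pos : ∀ t ∈ Ioo 0 T, ∀ x ∈ closure D, 0 < ρ t x
  density : ContDiffOn ℝ 1 (fun z : ℝ × Vec d => ρ z.1 z.2) (Ioo 0 T ×ˢ closure D)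
  momentum : ContDiffOn ℝ 1 (fun z : ℝ × Vec d => m z.1 z.2) (Ioo 0 T ×ˢ closure D)
  energy : ContDiffOn ℝ 1 (fun z : ℝ × Vec d => E z.1 z.2) (Ioo 0 T ×ˢ closure D)
  pressure : ContDiffOn ℝ 1
    (fun z : ℝ × Vec d => pressure P (ρ z.1 z.2) (m z.1 z.2) (E z.1 z.2)) (Ioo 0 T ×ˢ closure D)
  potential : ContDiffOn ℝ 3 (fun z : ℝ × Vec d => φ z.1 z.2) (Ioo 0 T ×ˢ closure D)

/-! ### The terms of the energy balance -/

/-- Total energy density `ℰ + |∇φ|²/(2α)` at time `t`. -/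
def energyDensity {d : ℕ} (α : ℝ) (E : ℝ → Vec d → ℝ) (φ : ℝ → Vec d → ℝ) (t : ℝ) (x : Vec d) : ℝ :=
  E t x + 1 / (2 * α) * ‖gradient (φ t) x‖ ^ 2

/-- Energy flux `ρ⁻¹ m (ℰ + p) + φ (m - α⁻¹ ∂ₜ∇φ)` at time `t`. The gradient is taken within the
closed domain, so that it is also meaningful at boundary points. -/
def energyFlux {d : ℕ} (D : Set (Vec d)) (α : ℝ) (P : ℝ → ℝ → ℝ) (ρ : ℝ → Vec d → ℝ)
    (m : ℝ → Vec d → Vec d) (E : ℝ → Vec d → ℝ) (φ : ℝ → Vec d → ℝ) (t : ℝ) (x : Vec d) : Vec d :=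
  ((ρ t x)⁻¹ * (E t x + pressure P (ρ t x) (m t x) (E t x))) • m t x
    + φ t x • (m t x - α⁻¹ • deriv (fun s => gradientWithin (φ s) (closure D) x) t)

end MagneticEulerPoisson

end

/-! The total energy obeys a local conservation law, and integrating it over `D` with the divergence
theorem gives the claim. Differentiating |∇φ|²/(2α) in time yields α⁻¹∇φ·∂ₜ∇φ. On the other hand,
∇·(φ(m − α⁻¹∂ₜ∇φ)) = ∇φ·(m − α⁻¹∂ₜ∇φ) + φ∇·(m − α⁻¹∂ₜ∇φ), and the last term vanishes because ∂ₜΔφ =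
α∇·m and ∂ₜ commutes with the space derivatives. The source −m·∇φ of the energy equation is thereby
absorbed, and the density changes at the rate of minus the divergence of the flux
(`SolvesEquations.deriv_energyDensityWithin`). `hasDerivAt_setIntegral` moves the time derivative
under the integral.

Most of the work is the divergence theorem on Lipschitz domains, with Hausdorff measure on the
boundary (`IsLipschitzDomain.integral_divergence`). Above a Lipschitz graph, a constant direction
splits into a part tangent to the vertical translates of the graph, which integrates to zero over
each of them, and a vertical part, to which the fundamental theorem of calculus applies
(`IsGaussAbove.integral_fderiv`). The area formula `comap_graphMap_euclideanHausdorffMeasure` turns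
the resulting integral over the base into a surface integral: by Rademacher's theorem the graph is
nearly affine on countably many measurable pieces covering almost everything, and there it is
compared with its linear model. Bump functions glue the charts (`IsLipschitzDomain.gaussFormula`).

Regularity up to the boundary is handled by derivatives within the closure. They are unique because
the closure contains a cone at every boundary point (`IsLipschitzDomain.uniqueDiffOn_closure`). -/

noncomputable section

namespace MagneticEulerPoisson

/-! ### The area formula for Lipschitz graphs. -/

section AreaFormula

open scoped ENNReal

/-- If `f` contracts distances relative to `g` by a factor `K` on `s`, then the Hausdorff measures
of the images compare accordingly. -/
theorem euclideanHausdorffMeasure_image_le_of_edist_le {X Y Z : Type*} [EMetricSpace Y]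
    [MeasurableSpace Y] [BorelSpace Y] [EMetricSpace Z] [MeasurableSpace Z] [BorelSpace Z]
    {f : X → Y} {g : X → Z} {s : Set X} {K : ℝ≥0} (n : ℕ)
    (h : ∀ x ∈ s, ∀ y ∈ s, edist (f x) (f y) ≤ K * edist (g x) (g y)) :
    μHE[n] (f '' s) ≤ (K : ℝ≥0∞) ^ n * μHE[n] (g '' s) := by
  rcases s.eq_empty_or_nonempty with rfl | ⟨x₀, hx₀⟩
  · simp
  have : Nonempty X := ⟨x₀⟩
  -- On `s`, equal values of `g` force equal values of `f`, so `f` factors through `g` by a map that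
  -- is `K`-Lipschitz on `g '' s`.
  set k : Z → Y := fun z => f (Function.invFunOn g s z) with hk
  have hmem : ∀ x ∈ s, Function.invFunOn g s (g x) ∈ s := fun x hx =>
    Function.invFunOn_mem ⟨x, hx, rfl⟩
  have heq : ∀ x ∈ s, g (Function.invFunOn g s (g x)) = g x := fun x hx =>
    Function.invFunOn_eq ⟨x, hx, rfl⟩
  have hkg : ∀ x ∈ s, k (g x) = f x := by
    intro x hx
    have := h _ (hmem x hx) x hx
    rw [heq x hx, edist_self, mul_zero] at this
    exact edist_le_zero.1 this
  have himage : f '' s = k '' (g '' s) := by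
    rw [image_image]
    exact image_congr fun x hx => (hkg x hx).symm
  have hlip : LipschitzOnWith K k (g '' s) := by
    rintro _ ⟨x, hx, rfl⟩ _ ⟨y, hy, rfl⟩
    rw [hkg x hx, hkg y hy]
    exact h x hx y hy
  have := hlip.hausdorffMeasure_image_le (d := n) (by positivity)
  rw [himage]
  simp only [Measure.euclideanHausdorffMeasure_def, Measure.smul_apply]
  rw [ENNReal.rpow_natCast] at this
  rw [ENNReal.smul_def, ENNReal.smul_def, smul_eq_mul, smul_eq_mul, mul_left_comm]
  gcongr

variable {n : ℕ}

/-- The parametrization `x ↦ (x, γ x)` of the graph of `γ`. -/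
def graphMap (γ : Vec n → ℝ) (x : Vec n) : WithLp 2 (Vec n × ℝ) := WithLp.toLp 2 (x, γ x)

/-- The Jacobian of a graph with slope `a`. -/
def graphJacobian (a : Vec n →L[ℝ] ℝ) : ℝ := √(1 + ‖a‖ ^ 2)

theorem one_le_graphJacobian (a : Vec n →L[ℝ] ℝ) : 1 ≤ graphJacobian a := by
  rw [graphJacobian, Real.le_sqrt (by norm_num) (by positivity)]
  nlinarith [sq_nonneg ‖a‖]

theorem graphJacobian_sq (a : Vec n →L[ℝ] ℝ) : graphJacobian a ^ 2 = 1 + ‖a‖ ^ 2 :=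
  Real.sq_sqrt (by positivity)

theorem continuous_graphJacobian : Continuous (graphJacobian (n := n)) := by
  unfold graphJacobian; fun_prop

/-- The function √(1 + r²) is 1-Lipschitz, so the Jacobian varies no faster than the slope. -/
theorem graphJacobian_le_add (a b : Vec n →L[ℝ] ℝ) :
    graphJacobian a ≤ graphJacobian b + ‖a - b‖ := by
  have h1 := graphJacobian_sq b
  have h2 : ‖a‖ ≤ ‖b‖ + ‖a - b‖ := by
    have := norm_add_le b (a - b)
    rwa [add_sub_cancel] at this
  have h3 : ‖b‖ ≤ graphJacobian b := Real.le_sqrt_of_sq_le (by linarith)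
  have h4 := one_le_graphJacobian b
  rw [graphJacobian, Real.sqrt_le_iff]
  refine ⟨by positivity, ?_⟩
  nlinarith [norm_nonneg a, norm_nonneg b, norm_nonneg (a - b),
    mul_le_mul_of_nonneg_right h3 (norm_nonneg (a - b))]

/-- The linear map `v ↦ (v, a v)`. -/
def graphLinear (a : Vec n →L[ℝ] ℝ) : Vec n →ₗ[ℝ] WithLp 2 (Vec n × ℝ) :=
  (WithLp.linearEquiv 2 ℝ (Vec n × ℝ)).symm.toLinearMap ∘ₗ (LinearMap.id.prod a.toLinearMap)

theorem graphLinear_apply (a : Vec n →L[ℝ] ℝ) (v : Vec n) :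
    graphLinear a v = WithLp.toLp 2 (v, a v) := rfl

theorem norm_le_norm_graphLinear (a : Vec n →L[ℝ] ℝ) (v : Vec n) : ‖v‖ ≤ ‖graphLinear a v‖ := by
  rw [WithLp.prod_norm_eq_of_L2]
  apply Real.le_sqrt_of_sq_le
  simp [graphLinear_apply]
  positivity

theorem sum_apply_sq_eq_norm_sq (a : Vec n →L[ℝ] ℝ) {ι : Type*} [Fintype ι]
    (b : OrthonormalBasis ι ℝ (Vec n)) : ∑ i, a (b i) ^ 2 = ‖a‖ ^ 2 := by
  obtain ⟨g, rfl⟩ := (InnerProductSpace.toDual ℝ (Vec n)).surjective a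
  rw [LinearIsometryEquiv.norm_map, ← b.sum_sq_norm_inner_right g]
  simp [real_inner_comm]

/-- The Gram matrix of the images of an orthonormal basis is the identity plus a rank-one matrix, so
the matrix determinant lemma gives 1 + ‖a‖². -/
theorem normDet_graphLinear (a : Vec n →L[ℝ] ℝ) : (graphLinear a).normDet = graphJacobian a := by
  rw [← sq_eq_sq₀ (LinearMap.normDet_nonneg _)
    (zero_le_one.trans (one_le_graphJacobian a)), graphJacobian_sq]
  set b := EuclideanSpace.basisFun (Fin n) ℝ
  have h := (graphLinear a).normDet_sq_eq_det_gram b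
  have hgram : Matrix.gram ℝ (fun i => graphLinear a (b i))
      = 1 + Matrix.replicateCol Unit (fun i => a (b i)) * Matrix.replicateRow Unit (fun i => a (b i)) := by
    ext i j
    rw [Matrix.gram_apply, graphLinear_apply, graphLinear_apply, WithLp.prod_inner_apply]
    simp [Matrix.one_apply, orthonormal_iff_ite.1 b.orthonormal, Matrix.mul_apply, mul_comm]
  rw [hgram, Matrix.det_one_add_replicateCol_mul_replicateRow] at h
  rw [← sum_apply_sq_eq_norm_sq a b]
  simpa [dotProduct, sq] using h

theorem euclideanHausdorffMeasure_graphLinear_image (a : Vec n →L[ℝ] ℝ) (s : Set (Vec n)) :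
    μHE[n] (graphLinear a '' s) = ENNReal.ofReal (graphJacobian a) * volume s := by
  have := (graphLinear a).euclideanHausdorffMeasure_image_eq_normDet_mul_volume s
  rwa [finrank_euclideanSpace_fin, normDet_graphLinear] at this

/-- The two displacements have the same horizontal part, so their difference is the linearization
error of `γ`, while the linear displacement is at least as long as its horizontal part. -/
theorem dist_graphMap_sub_graphLinear_le {γ : Vec n → ℝ} {A : Vec n →L[ℝ] ℝ} {s : Set (Vec n)}
    {η : ℝ≥0} (h : ApproximatesLinearOn γ A s η) {x y : Vec n} (hx : x ∈ s) (hy : y ∈ s) :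
    ‖(graphMap γ x - graphMap γ y) - (graphLinear A x - graphLinear A y)‖
      ≤ η * ‖graphLinear A x - graphLinear A y‖ := by
  have e : (graphMap γ x - graphMap γ y) - (graphLinear A x - graphLinear A y)
      = WithLp.toLp 2 ((0 : Vec n), γ x - γ y - A (x - y)) := by
    simp only [graphMap, graphLinear_apply, ← WithLp.toLp_sub, Prod.mk_sub_mk]
    simp
  rw [e, WithLp.prod_norm_eq_of_L2]
  have e2 : ‖(WithLp.toLp 2 ((0 : Vec n), γ x - γ y - A (x - y))).fst‖ = 0 := norm_zero
  rw [e2, zero_pow two_ne_zero, zero_add, Real.sqrt_sq (norm_nonneg _)]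
  calc |γ x - γ y - A (x - y)| ≤ η * ‖x - y‖ := h x hx y hy
    _ ≤ η * ‖graphLinear A x - graphLinear A y‖ := by
      rw [← map_sub]
      gcongr
      exact norm_le_norm_graphLinear A _

theorem edist_graphMap_le {γ : Vec n → ℝ} {A : Vec n →L[ℝ] ℝ} {s : Set (Vec n)}
    {η K : ℝ≥0} (h : ApproximatesLinearOn γ A s η) (hK : 1 + η ≤ K) {x y : Vec n}
    (hx : x ∈ s) (hy : y ∈ s) :
    edist (graphMap γ x) (graphMap γ y) ≤ K * edist (graphLinear A x) (graphLinear A y) := by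
  have h1 := dist_graphMap_sub_graphLinear_le h hx hy
  have h2 := norm_le_norm_add_norm_sub' (graphMap γ x - graphMap γ y)
    (graphLinear A x - graphLinear A y)
  have h3 : (1 : ℝ) + η ≤ K := mod_cast hK
  rw [edist_nndist, edist_nndist, ← ENNReal.coe_mul, ENNReal.coe_le_coe, ← NNReal.coe_le_coe]
  push_cast
  rw [dist_eq_norm, dist_eq_norm]
  nlinarith [norm_nonneg (graphLinear A x - graphLinear A y)]

theorem edist_graphLinear_le {γ : Vec n → ℝ} {A : Vec n →L[ℝ] ℝ} {s : Set (Vec n)}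
    {η K : ℝ≥0} (h : ApproximatesLinearOn γ A s η) (hK : 1 + K * η ≤ K) {x y : Vec n}
    (hx : x ∈ s) (hy : y ∈ s) :
    edist (graphLinear A x) (graphLinear A y) ≤ K * edist (graphMap γ x) (graphMap γ y) := by
  have h1 := dist_graphMap_sub_graphLinear_le h hx hy
  have h2 := norm_le_norm_add_norm_sub (graphMap γ x - graphMap γ y)
    (graphLinear A x - graphLinear A y)
  have h3 : (1 : ℝ) + K * η ≤ K := mod_cast hK
  rw [edist_nndist, edist_nndist, ← ENNReal.coe_mul, ENNReal.coe_le_coe, ← NNReal.coe_le_coe]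
  push_cast
  rw [dist_eq_norm, dist_eq_norm]
  have h4 : ‖graphLinear A x - graphLinear A y‖ * (1 - η)
      ≤ ‖graphMap γ x - graphMap γ y‖ := by linarith
  have h5 := mul_le_mul_of_nonneg_left h4 K.coe_nonneg
  nlinarith [norm_nonneg (graphLinear A x - graphLinear A y)]

/-- Comparison of measures can be checked on a countable measurable cover. -/
theorem measure_le_of_forall_subset_le {α : Type*} [MeasurableSpace α] {μ ν : Measure α}
    {t : ℕ → Set α} (ht : ∀ i, MeasurableSet (t i)) (hcover : ∀ᵐ x ∂μ, x ∈ ⋃ i, t i)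
    (h : ∀ i, ∀ s ⊆ t i, MeasurableSet s → μ s ≤ ν s) : μ ≤ ν := by
  refine Measure.le_iff.2 fun s hs => ?_
  have hd : ∀ i, MeasurableSet (disjointed t i) := fun i => MeasurableSet.disjointed ht i
  have hdisj : Pairwise (Function.onFun Disjoint fun i => s ∩ disjointed t i) := fun i j hij =>
    (disjoint_disjointed t hij).mono inter_subset_right inter_subset_right
  calc μ s = μ (s ∩ ⋃ i, t i) := by
        refine (measure_congr ?_).symm
        filter_upwards [hcover] with x hx
        exact propext ⟨fun h => h.1, fun h => ⟨h, hx⟩⟩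
    _ = μ (⋃ i, s ∩ disjointed t i) := by rw [← inter_iUnion, iUnion_disjointed]
    _ = ∑' i, μ (s ∩ disjointed t i) := measure_iUnion hdisj fun i => hs.inter (hd i)
    _ ≤ ∑' i, ν (s ∩ disjointed t i) := ENNReal.tsum_le_tsum fun i =>
        h i _ (inter_subset_right.trans (disjointed_subset t i)) (hs.inter (hd i))
    _ = ν (⋃ i, s ∩ disjointed t i) := (measure_iUnion hdisj fun i => hs.inter (hd i)).symm
    _ ≤ ν s := measure_mono (iUnion_subset fun i => inter_subset_left)

theorem graphMap_injective (γ : Vec n → ℝ) : Function.Injective (graphMap γ) := fun x y h => by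
  have := congrArg WithLp.fst h
  exact this

theorem continuous_graphMap {γ : Vec n → ℝ} (hγ : Continuous γ) : Continuous (graphMap γ) :=
  (WithLp.prod_continuous_toLp 2 _ _).comp (continuous_id.prodMk hγ)

theorem measurableEmbedding_graphMap {γ : Vec n → ℝ} (hγ : Continuous γ) :
    MeasurableEmbedding (graphMap γ) :=
  (continuous_graphMap hγ).measurableEmbedding (graphMap_injective γ)

/-- Jacobian density of the graph of `γ`. -/
def graphMeasure (γ : Vec n → ℝ) : Measure (Vec n) :=
  volume.withDensity fun x => ENNReal.ofReal (graphJacobian (fderiv ℝ γ x))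

theorem graphMeasure_apply (γ : Vec n → ℝ) {s : Set (Vec n)} (hs : MeasurableSet s) :
    graphMeasure γ s = ∫⁻ x in s, ENNReal.ofReal (graphJacobian (fderiv ℝ γ x)) :=
  withDensity_apply _ hs

/-- On a piece where `γ` is nearly linear, the Hausdorff measure of the graph and the integral of
the Jacobian agree up to a factor close to one. -/
theorem graphMeasure_comparable_of_approximatesLinearOn {γ : Vec n → ℝ} (hγ : Continuous γ)
    {A : Vec n →L[ℝ] ℝ} {s : Set (Vec n)} (hs : MeasurableSet s) {η K : ℝ≥0} (hK : 1 + η ≤ K)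
    (hK' : 1 + K * η ≤ K) (h : ApproximatesLinearOn γ A s η)
    (hA : ∀ x ∈ s, ‖fderiv ℝ γ x - A‖ ≤ η) :
    graphMeasure γ s ≤ (K : ℝ≥0∞) ^ (n + 1) * (Measure.comap (graphMap γ) μHE[n]) s ∧
      (Measure.comap (graphMap γ) μHE[n]) s ≤ (K : ℝ≥0∞) ^ (n + 1) * graphMeasure γ s := by
  have hJ : ∀ a b : Vec n →L[ℝ] ℝ, ‖a - b‖ ≤ η →
      ENNReal.ofReal (graphJacobian a) ≤ K * ENNReal.ofReal (graphJacobian b) := by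
    intro a b hab
    rw [← ENNReal.ofReal_coe_nnreal, ← ENNReal.ofReal_mul K.coe_nonneg]
    refine ENNReal.ofReal_le_ofReal ?_
    have h1 := graphJacobian_le_add a b
    have h2 := one_le_graphJacobian b
    have h3 : (1 : ℝ) + η ≤ K := mod_cast hK
    nlinarith [η.coe_nonneg]
  have h1 := euclideanHausdorffMeasure_image_le_of_edist_le n
    (fun x hx y hy => edist_graphMap_le h hK hx hy)
  have h2 := euclideanHausdorffMeasure_image_le_of_edist_le n
    (fun x hx y hy => edist_graphLinear_le h hK' hx hy)
  rw [euclideanHausdorffMeasure_graphLinear_image] at h1 h2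
  rw [(measurableEmbedding_graphMap hγ).comap_apply, graphMeasure_apply _ hs]
  -- In both directions `K ^ n` pays for comparing Hausdorff measures and one more factor `K` for
  -- replacing the Jacobian of `γ` by that of `A`.
  constructor
  · calc ∫⁻ x in s, ENNReal.ofReal (graphJacobian (fderiv ℝ γ x))
        ≤ ∫⁻ _ in s, K * ENNReal.ofReal (graphJacobian A) :=
          setLIntegral_mono measurable_const fun x hx => hJ _ _ (hA x hx)
      _ = K * (ENNReal.ofReal (graphJacobian A) * volume s) := by
          rw [setLIntegral_const, mul_assoc]
      _ ≤ K * (K ^ n * μHE[n] (graphMap γ '' s)) := by gcongr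
      _ = _ := by ring
  · calc μHE[n] (graphMap γ '' s) ≤ K ^ n * (ENNReal.ofReal (graphJacobian A) * volume s) := h1
      _ = K ^ n * ∫⁻ _ in s, ENNReal.ofReal (graphJacobian A) := by rw [setLIntegral_const]
      _ ≤ K ^ n * ∫⁻ x in s, K * ENNReal.ofReal (graphJacobian (fderiv ℝ γ x)) := by
          gcongr 1
          refine setLIntegral_mono' hs fun x hx => hJ _ _ ?_
          rw [norm_sub_rev]
          exact hA x hx
      _ = _ := by rw [lintegral_const_mul' _ _ ENNReal.coe_ne_top]; ring

/-- Cutting first by the value of the derivative, and only then into pieces of near linearity, makes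
the approximating map close to the derivative at every point of a piece, as the comparison of
Jacobians requires. -/
theorem exists_nearly_linear_cover (γ : Vec n → ℝ) {η : ℝ≥0} (hη : 0 < η) :
    ∃ t : ℕ → Set (Vec n), (∀ i, MeasurableSet (t i)) ∧
      {x | DifferentiableAt ℝ γ x} ⊆ ⋃ i, t i ∧
      ∀ i, ∃ A : Vec n →L[ℝ] ℝ, ApproximatesLinearOn γ A (t i) η ∧
        ∀ x ∈ t i, ‖fderiv ℝ γ x - A‖ ≤ η := by
  let q := TopologicalSpace.denseSeq (Vec n →L[ℝ] ℝ)
  -- The radius is `η / 2` because the linear map chosen on a piece is the derivative at some point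
  -- of `s m`; it and the derivative at any other point of `s m` are both that close to `q m`.
  let s : ℕ → Set (Vec n) := fun m =>
    {x | DifferentiableAt ℝ γ x} ∩ {x | fderiv ℝ γ x ∈ Metric.ball (q m) (η / 2)}
  have hs : ∀ m, MeasurableSet (s m) := fun m =>
    (measurableSet_of_differentiableAt ℝ γ).inter
      (measurable_fderiv ℝ γ Metric.isOpen_ball.measurableSet)
  have hp : ∀ m, ∃ (t : ℕ → Set (Vec n)) (A : ℕ → Vec n →L[ℝ] ℝ),
      (∀ k, MeasurableSet (t k)) ∧ s m ⊆ ⋃ k, t k ∧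
      (∀ k, ApproximatesLinearOn γ (A k) (s m ∩ t k) η) ∧
      ((s m).Nonempty → ∀ k, ∃ y ∈ s m, A k = fderiv ℝ γ y) := fun m => by
    obtain ⟨t, A, -, h1, h2, h3, h4⟩ :=
      exists_partition_approximatesLinearOn_of_hasFDerivWithinAt γ (s m) (fderiv ℝ γ)
        (fun x hx => hx.1.hasFDerivAt.hasFDerivWithinAt) (fun _ => η) (fun _ => hη.ne')
    exact ⟨t, A, h1, h2, h3, h4⟩
  choose t A ht1 ht2 ht3 ht4 using hp
  refine ⟨fun i => s i.unpair.1 ∩ t i.unpair.1 i.unpair.2, fun i => (hs _).inter (ht1 _ _),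
    fun x hx => ?_, fun i => ⟨A i.unpair.1 i.unpair.2, ht3 _ _, fun x hx => ?_⟩⟩
  · obtain ⟨m, hm⟩ := (TopologicalSpace.denseRange_denseSeq (Vec n →L[ℝ] ℝ)).exists_dist_lt
      (fderiv ℝ γ x) (half_pos (show (0 : ℝ) < η from hη))
    have hxm : x ∈ s m := ⟨hx, hm⟩
    obtain ⟨k, hk⟩ := mem_iUnion.1 (ht2 m hxm)
    exact mem_iUnion.2 ⟨Nat.pair m k, by simpa using ⟨hxm, hk⟩⟩
  · obtain ⟨y, hy, hAy⟩ := ht4 i.unpair.1 ⟨x, hx.1⟩ i.unpair.2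
    rw [hAy, ← dist_eq_norm]
    have h1 := hx.1.2
    have h2 := hy.2
    rw [mem_ofPred_eq, Metric.mem_ball] at h1 h2
    have := dist_triangle_right (fderiv ℝ γ x) (fderiv ℝ γ y) (q i.unpair.1)
    linarith

theorem lipschitzWith_graphMap {γ : Vec n → ℝ} {C : ℝ≥0} (hγ : LipschitzWith C γ) :
    ∃ C' : ℝ≥0, LipschitzWith C' (graphMap γ) :=
  ⟨_, (WithLp.prod_lipschitzWith_toLp 2 (Vec n) ℝ).comp (LipschitzWith.id.prodMk hγ)⟩

/-- The area formula for Lipschitz graphs. -/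
theorem comap_graphMap_euclideanHausdorffMeasure {γ : Vec n → ℝ} {C : ℝ≥0}
    (hγ : LipschitzWith C γ) : Measure.comap (graphMap γ) μHE[n] = graphMeasure γ := by
  have hemb := measurableEmbedding_graphMap hγ.continuous
  have hdiff : ∀ᵐ x : Vec n, DifferentiableAt ℝ γ x := hγ.ae_differentiableAt
  -- The pieces miss the points of non-differentiability. These are Lebesgue null by Rademacher, and
  -- the Lipschitz map `graphMap γ` carries null sets to null sets.
  have hac : ∀ s : Set (Vec n), volume s = 0 → Measure.comap (graphMap γ) μHE[n] s = 0 := by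
    intro s hs
    obtain ⟨C', hC'⟩ := lipschitzWith_graphMap hγ
    rw [hemb.comap_apply]
    have := euclideanHausdorffMeasure_image_le_of_edist_le (f := graphMap γ) (g := id) (s := s) n
      (fun x _ y _ => hC' x y)
    rw [image_id, EuclideanSpace.euclideanHausdorffMeasure_eq_volume, hs, mul_zero] at this
    exact le_antisymm this (zero_le)
  have hcomp : ∀ K : ℝ≥0, 1 < K →
      graphMeasure γ ≤ (K : ℝ≥0∞) ^ (n + 1) • Measure.comap (graphMap γ) μHE[n] ∧
      Measure.comap (graphMap γ) μHE[n] ≤ (K : ℝ≥0∞) ^ (n + 1) • graphMeasure γ := by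
    intro K hK
    have hK1 : (1 : ℝ) < K := mod_cast hK
    -- This is the value for which `1 + K * η = K` holds exactly; `1 + η ≤ K` then follows from `K +
    -- 1 / K ≥ 2`.
    let η : ℝ≥0 := ⟨1 - (K : ℝ)⁻¹, by
      have := inv_le_one_of_one_le₀ hK1.le
      linarith⟩
    have hη : (η : ℝ) = 1 - (K : ℝ)⁻¹ := rfl
    have hη0 : 0 < η := by
      have := inv_lt_one_of_one_lt₀ hK1
      exact NNReal.coe_pos.1 (by rw [hη]; linarith)
    have e1 : (K : ℝ) * (K : ℝ)⁻¹ = 1 := mul_inv_cancel₀ (by positivity)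
    have hKη : 1 + η ≤ K := by
      rw [← NNReal.coe_le_coe]
      push_cast
      rw [hη]
      nlinarith [sq_nonneg ((K : ℝ) - 1), inv_pos.2 (zero_lt_one.trans hK1)]
    have hKη' : 1 + K * η ≤ K := by
      rw [← NNReal.coe_le_coe]
      push_cast
      rw [hη]
      nlinarith
    obtain ⟨t, ht, hcov, hA⟩ := exists_nearly_linear_cover γ hη0
    have hae : ∀ᵐ x : Vec n, x ∈ ⋃ i, t i := hdiff.mono fun x hx => hcov hx
    have hpiece : ∀ i, ∀ s ⊆ t i, MeasurableSet s →
        graphMeasure γ s ≤ (K : ℝ≥0∞) ^ (n + 1) * (Measure.comap (graphMap γ) μHE[n]) s ∧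
        (Measure.comap (graphMap γ) μHE[n]) s ≤ (K : ℝ≥0∞) ^ (n + 1) * graphMeasure γ s := by
      intro i s hs hm
      obtain ⟨A, hA1, hA2⟩ := hA i
      exact graphMeasure_comparable_of_approximatesLinearOn hγ.continuous hm hKη hKη'
        (hA1.mono_set hs) fun x hx => hA2 x (hs hx)
    refine ⟨measure_le_of_forall_subset_le ht (withDensity_absolutelyContinuous _ _ hae)
      fun i s hs hm => (hpiece i s hs hm).1, measure_le_of_forall_subset_le ht (hac _ hae)
      fun i s hs hm => (hpiece i s hs hm).2⟩
  -- The comparison factor disappears on letting `K` decrease to 1.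
  have hlim : ∀ μ ν : Measure (Vec n),
      (∀ K : ℝ≥0, 1 < K → μ ≤ (K : ℝ≥0∞) ^ (n + 1) • ν) → μ ≤ ν := by
    intro μ ν h
    refine Measure.le_iff.2 fun s _ => ?_
    by_cases hν : ν s = ∞
    · rw [hν]; exact le_top
    have h1 : Tendsto (fun K : ℝ≥0 => (K : ℝ≥0∞) ^ (n + 1) * ν s) (𝓝[>] 1) (𝓝 (1 * ν s)) := by
      refine ENNReal.Tendsto.mul_const ?_ (Or.inr hν)
      have : Tendsto (fun K : ℝ≥0 => ((K ^ (n + 1) : ℝ≥0) : ℝ≥0∞)) (𝓝[>] 1) (𝓝 (1 : ℝ≥0)) := by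
        refine ENNReal.tendsto_coe.2 ?_
        have := (continuous_pow (M := ℝ≥0) (n + 1)).tendsto 1
        rw [one_pow] at this
        exact this.mono_left nhdsWithin_le_nhds
      simpa using this
    rw [one_mul] at h1
    refine ge_of_tendsto h1 ?_
    filter_upwards [self_mem_nhdsWithin] with K hK
    exact h K hK s
  exact le_antisymm (hlim _ _ fun K hK => (hcomp K hK).2) (hlim _ _ fun K hK => (hcomp K hK).1)

end AreaFormula

/-! ### Gauss' formula above a Lipschitz graph. -/

section GraphGauss

/-- Compactness gives a Lipschitz constant on a ball one unit larger than one containing the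
support. A point of the smaller ball and a point outside the larger one are at distance at least 1,
so there a bound for |f| serves as the constant. -/
theorem LocallyLipschitz.exists_lipschitzWith_of_hasCompactSupport {E : Type*}
    [NormedAddCommGroup E] [NormedSpace ℝ E] [FiniteDimensional ℝ E] {f : E → ℝ}
    (hf : LocallyLipschitz f) (hs : HasCompactSupport f) : ∃ K, LipschitzWith K f := by
  obtain ⟨R, hR⟩ := hs.isCompact.isBounded.subset_closedBall (0 : E)
  have hzero : ∀ x, x ∉ Metric.closedBall (0 : E) R → f x = 0 := fun x hx =>
    image_eq_zero_of_notMem_tsupport fun h => hx (hR h)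
  obtain ⟨K, hK⟩ := (hf.locallyLipschitzOn (s := Metric.closedBall (0 : E) (R + 1)))
    |>.exists_lipschitzOnWith_of_compact (isCompact_closedBall (0 : E) (R + 1))
  obtain ⟨M, hM⟩ := hs.exists_bound_of_continuous hf.continuous
  have hM0 : 0 ≤ M := (norm_nonneg _).trans (hM 0)
  have key : ∀ x y, x ∈ Metric.closedBall (0 : E) R →
      |f x - f y| ≤ max (K : ℝ) M * ‖x - y‖ := by
    intro x y hx
    by_cases hy : y ∈ Metric.closedBall (0 : E) (R + 1)
    · have := hK.dist_le_mul x (Metric.closedBall_subset_closedBall (by linarith) hx) y hy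
      rw [Real.dist_eq, dist_eq_norm] at this
      exact this.trans (by gcongr; exact le_max_left _ _)
    · have hy0 : f y = 0 := hzero y fun h =>
        hy (Metric.closedBall_subset_closedBall (by linarith) h)
      simp only [Metric.mem_closedBall, dist_zero_right, not_le] at hx hy
      have h1 : 1 ≤ ‖x - y‖ := by
        have := norm_sub_norm_le y x
        rw [norm_sub_rev] at this
        linarith
      rw [hy0, sub_zero]
      calc |f x| ≤ M := hM x
        _ ≤ M * ‖x - y‖ := le_mul_of_one_le_right hM0 h1
        _ ≤ _ := by gcongr; exact le_max_right _ _
  refine ⟨⟨max (K : ℝ) M, le_max_of_le_right hM0⟩, LipschitzWith.of_dist_le_mul fun x y => ?_⟩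
  rw [Real.dist_eq, dist_eq_norm]
  by_cases hx : x ∈ Metric.closedBall (0 : E) R
  · exact key x y hx
  by_cases hy : y ∈ Metric.closedBall (0 : E) R
  · rw [abs_sub_comm, norm_sub_rev]
    exact key y x hy
  · rw [hzero x hx, hzero y hy, sub_self, abs_zero]
    exact mul_nonneg (le_max_of_le_right hM0) (norm_nonneg _)

/-- Integration by parts for Lipschitz functions, against the constant 1. -/
theorem integral_lineDeriv_eq_zero {n : ℕ} {f : Vec n → ℝ} (hf : LocallyLipschitz f)
    (hs : HasCompactSupport f) (v : Vec n) : ∫ x, lineDeriv ℝ f x v = 0 := by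
  obtain ⟨K, hK⟩ := LocallyLipschitz.exists_lipschitzWith_of_hasCompactSupport hf hs
  have := LipschitzWith.integral_lineDeriv_mul_eq (μ := (volume : Measure (Vec n)))
    (LipschitzWith.const (1 : ℝ)) hK hs (-v)
  simpa [lineDeriv] using this.symm

theorem integrableOn_of_bounded_of_eq_zero {X : Type*} [MeasurableSpace X] {μ : Measure X}
    {g : X → ℝ} {s t : Set X} (hg : Measurable g) (hs : MeasurableSet s)
    (ht : μ t ≠ ⊤) (hts : t ⊆ s) {M : ℝ} (hM : ∀ x ∈ s, ‖g x‖ ≤ M) (htm : MeasurableSet t)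
    (h0 : ∀ x ∈ s \ t, g x = 0) : IntegrableOn g s μ :=
  IntegrableOn.of_forall_sdiff_eq_zero
    (Measure.integrableOn_of_bounded ht hg.aestronglyMeasurable
      ((ae_restrict_iff' htm).2 (Eventually.of_forall fun x hx => hM x (hts hx)))) hs h0

variable {n : ℕ}

/-- The shear carrying the upper half space to the region above the graph of `γ`. -/
def graphShear (γ : Vec n → ℝ) (z : Vec n × ℝ) : Vec n × ℝ := (z.1, γ z.1 + z.2)

theorem continuous_graphShear {γ : Vec n → ℝ} (hγ : Continuous γ) :
    Continuous (graphShear γ) := by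
  unfold graphShear; fun_prop

theorem measurableEmbedding_graphShear {γ : Vec n → ℝ} (hγ : Continuous γ) :
    MeasurableEmbedding (graphShear γ) := by
  refine (continuous_graphShear hγ).measurableEmbedding fun x y h => ?_
  simp only [graphShear, Prod.mk.injEq] at h
  obtain ⟨h1, h2⟩ := h
  rw [h1] at h2
  exact Prod.ext h1 (add_left_cancel h2)

/-- Each vertical fibre is merely translated, by `γ x`. -/
theorem measurePreserving_graphShear {γ : Vec n → ℝ} (hγ : Continuous γ) :
    MeasurePreserving (graphShear γ) :=
  (MeasurePreserving.id volume).skew_product (g := fun x s => γ x + s)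
    (by have := hγ.measurable; unfold Function.uncurry; fun_prop)
    (Eventually.of_forall fun x => (measurePreserving_add_left volume (γ x)).map_eq)

/-- The hypotheses of the Gauss formula above a graph. -/
structure IsGaussAbove (γ : Vec n → ℝ) (f : Vec n × ℝ → ℝ) : Prop where
  continuousOn : ContinuousOn f {z | γ z.1 ≤ z.2}
  contDiffOn : ContDiffOn ℝ 1 f {z | γ z.1 < z.2}
  exists_bound : ∃ B, ∀ z : Vec n × ℝ, γ z.1 < z.2 → ‖fderiv ℝ f z‖ ≤ B
  exists_radius : ∃ R, ∀ z : Vec n × ℝ, γ z.1 ≤ z.2 → R < ‖z‖ → f z = 0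

theorem isOpen_above {γ : Vec n → ℝ} (hγ : Continuous γ) :
    IsOpen {z : Vec n × ℝ | γ z.1 < z.2} :=
  isOpen_lt (hγ.comp continuous_fst) continuous_snd

variable {γ : Vec n → ℝ} {f : Vec n × ℝ → ℝ}

namespace IsGaussAbove

theorem contDiffAt (hf : IsGaussAbove γ f) (hγ : Continuous γ) (x : Vec n) {s : ℝ} (hs : 0 < s) :
    ContDiffAt ℝ 1 f (x, γ x + s) :=
  hf.contDiffOn.contDiffAt ((isOpen_above hγ).mem_nhds (by simpa using hs))

theorem differentiableAt (hf : IsGaussAbove γ f) (hγ : Continuous γ) (x : Vec n) {s : ℝ}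
    (hs : 0 < s) : DifferentiableAt ℝ f (x, γ x + s) :=
  (hf.contDiffAt hγ x hs).differentiableAt one_ne_zero

/-- In sheared coordinates `f` vanishes outside a bounded set. -/
theorem exists_radius_shear (hf : IsGaussAbove γ f) (hγ : Continuous γ) :
    ∃ R : ℝ, 0 ≤ R ∧ ∀ x : Vec n, ∀ s : ℝ, 0 ≤ s → ¬ (‖x‖ ≤ R ∧ s ≤ R) →
      f (x, γ x + s) = 0 ∧ (0 < s → fderiv ℝ f (x, γ x + s) = 0) := by
  obtain ⟨R, hR⟩ := hf.exists_radius
  obtain ⟨M, hM⟩ := (isCompact_closedBall (0 : Vec n) R).exists_bound_of_continuousOn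
    hγ.continuousOn
  -- If |γ x + s| ≤ R and |γ x| ≤ M, then s ≤ R + M.
  refine ⟨max 0 (max R (R + M)), le_max_left _ _, fun x s hs h => ?_⟩
  have hlarge : R < ‖(x, γ x + s)‖ := by
    by_contra! hle
    rw [Prod.norm_def, max_le_iff] at hle
    have h1 := hM x (by simpa using hle.1)
    have h2 := hle.2
    rw [Real.norm_eq_abs, abs_le] at h1 h2
    refine h ⟨hle.1.trans (le_max_of_le_right (le_max_left _ _)), ?_⟩
    exact le_max_of_le_right (le_max_of_le_right (by linarith))
  refine ⟨hR _ (by simpa using hs) hlarge, fun hs' => ?_⟩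
  have : f =ᶠ[𝓝 (x, γ x + s)] fun _ => 0 := by
    filter_upwards [(isOpen_above hγ).mem_nhds (show γ x < γ x + s by linarith),
      (isOpen_lt continuous_const continuous_norm).mem_nhds hlarge] with z hz1 hz2
    exact hR z (le_of_lt hz1) hz2
  rw [this.fderiv_eq]
  simp

theorem hasCompactSupport_slice (hf : IsGaussAbove γ f) (hγ : Continuous γ) {s : ℝ} (hs : 0 ≤ s) :
    HasCompactSupport fun x => f (x, γ x + s) := by
  obtain ⟨R, -, hR⟩ := hf.exists_radius_shear hγ
  refine HasCompactSupport.intro (isCompact_closedBall (0 : Vec n) R) fun x hx => ?_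
  exact (hR x s hs fun h => hx (by simpa using h.1)).1

theorem locallyLipschitz_slice (hf : IsGaussAbove γ f) {C : ℝ≥0} (hγ : LipschitzWith C γ) {s : ℝ}
    (hs : 0 < s) : LocallyLipschitz fun x => f (x, γ x + s) := by
  intro x
  obtain ⟨K, t, ht, hK⟩ := (hf.contDiffAt hγ.continuous x hs).exists_lipschitzOnWith
  have hl : LipschitzWith (max 1 C) fun y : Vec n => (y, γ y + s) :=
    LipschitzWith.id.prodMk (by simpa using hγ.add (LipschitzWith.const s))
  exact ⟨_, _, hl.continuous.continuousAt.preimage_mem_nhds ht,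
    hK.comp hl.lipschitzOnWith fun y hy => hy⟩

/-- By the chain rule, at almost every `x` the integrand is the derivative along `v` of `x ↦ f (x, γ
x + s)`. For `s > 0` this translate of the graph lies inside the region, so the function is locally
Lipschitz with compact support. -/
theorem integral_slice_eq_zero (hf : IsGaussAbove γ f) {C : ℝ≥0} (hγ : LipschitzWith C γ) {s : ℝ}
    (hs : 0 < s) (v : Vec n) :
    ∫ x, (fderiv ℝ f (x, γ x + s) (v, 0) + fderiv ℝ γ x v * fderiv ℝ f (x, γ x + s) (0, 1))
      = 0 := by
  refine (integral_congr_ae ?_).trans (integral_lineDeriv_eq_zero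
    (hf.locallyLipschitz_slice hγ hs) (hf.hasCompactSupport_slice hγ.continuous hs.le) v)
  filter_upwards [hγ.ae_differentiableAt] with x hx
  have h1 : HasFDerivAt (fun y : Vec n => (y, γ y + s))
      ((ContinuousLinearMap.id ℝ (Vec n)).prod (fderiv ℝ γ x)) x :=
    (hasFDerivAt_id x).prodMk (hx.hasFDerivAt.add_const s)
  have h2 := ((hf.differentiableAt hγ.continuous x hs).hasFDerivAt.comp x h1).hasLineDerivAt v
  have h3 : lineDeriv ℝ (fun y => f (y, γ y + s)) x v = _ := h2.lineDeriv
  rw [h3]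
  have : (v, fderiv ℝ γ x v) = (v, (0 : ℝ)) + fderiv ℝ γ x v • ((0 : Vec n), (1 : ℝ)) := by simp
  simp only [ContinuousLinearMap.comp_apply, ContinuousLinearMap.prod_apply,
    ContinuousLinearMap.id_apply]
  rw [this, map_add, map_smul, smul_eq_mul]

theorem measurable_fderiv_shear (f : Vec n × ℝ → ℝ) (hγ : Continuous γ) (w : Vec n × ℝ) :
    Measurable fun z : Vec n × ℝ => fderiv ℝ f (z.1, γ z.1 + z.2) w :=
  (measurable_fderiv_apply_const ℝ f w).comp (continuous_graphShear hγ).measurable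

theorem exists_bound_shear (hf : IsGaussAbove γ f) (w : Vec n × ℝ) :
    ∃ M, 0 ≤ M ∧ ∀ x : Vec n, ∀ s : ℝ, 0 < s → ‖fderiv ℝ f (x, γ x + s) w‖ ≤ M := by
  obtain ⟨B, hB⟩ := hf.exists_bound
  refine ⟨|B| * ‖w‖, by positivity, fun x s hs => ?_⟩
  refine (ContinuousLinearMap.le_opNorm _ _).trans ?_
  gcongr
  exact (hB (x, γ x + s) (show γ x < γ x + s by linarith)).trans (le_abs_self B)

theorem integrableOn_shear (hf : IsGaussAbove γ f) (hγ : Continuous γ) (w : Vec n × ℝ)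
    {a : Vec n → ℝ} (ha : Measurable a) {A : ℝ} (haA : ∀ x, ‖a x‖ ≤ A) :
    IntegrableOn (fun z : Vec n × ℝ => a z.1 * fderiv ℝ f (z.1, γ z.1 + z.2) w)
      (univ ×ˢ Ioi (0 : ℝ)) := by
  obtain ⟨M, hM0, hM⟩ := hf.exists_bound_shear w
  obtain ⟨R, hR0, hR⟩ := hf.exists_radius_shear hγ
  have hbound : ∀ z ∈ (univ : Set (Vec n)) ×ˢ Ioi (0 : ℝ),
      ‖a z.1 * fderiv ℝ f (z.1, γ z.1 + z.2) w‖ ≤ A * M := fun z hz => by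
    rw [norm_mul]
    exact mul_le_mul (haA _) (hM _ _ hz.2) (norm_nonneg _) ((norm_nonneg _).trans (haA z.1))
  refine integrableOn_of_bounded_of_eq_zero (t := Metric.closedBall (0 : Vec n) R ×ˢ Ioc 0 R)
    ((ha.comp measurable_fst).mul (measurable_fderiv_shear f hγ w))
    (MeasurableSet.univ.prod measurableSet_Ioi) ?_ (prod_mono (subset_univ _) Ioc_subset_Ioi_self)
    hbound (measurableSet_closedBall.prod measurableSet_Ioc) ?_
  · rw [Measure.volume_eq_prod, Measure.prod_prod]
    exact ENNReal.mul_ne_top measure_closedBall_lt_top.ne measure_Ioc_lt_top.ne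
  · rintro ⟨x, s⟩ ⟨⟨-, hs⟩, hn⟩
    have := (hR x s (le_of_lt hs) fun h => hn ⟨by simpa using h.1, hs, h.2⟩).2 hs
    simp [this]

/-- The fundamental theorem of calculus on a vertical ray. Continuity up to the graph gives the
endpoint value, and `f` vanishes far up. -/
theorem integral_vertical (hf : IsGaussAbove γ f) (hγ : Continuous γ) (x : Vec n) :
    ∫ s in Ioi (0 : ℝ), fderiv ℝ f (x, γ x + s) (0, 1) = -f (x, γ x) := by
  obtain ⟨M, hM0, hM⟩ := hf.exists_bound_shear (0, 1)
  obtain ⟨R, hR0, hR⟩ := hf.exists_radius_shear hγ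
  have hc : Continuous fun s : ℝ => (x, γ x + s) := by fun_prop
  have h := integral_Ioi_of_hasDerivAt_of_tendsto (f := fun s => f (x, γ x + s))
    (f' := fun s => fderiv ℝ f (x, γ x + s) (0, 1)) (a := 0) (m := 0) ?_ ?_ ?_ ?_
  · simpa using h
  · have h1 : ContinuousWithinAt f {z | γ z.1 ≤ z.2} (x, γ x + 0) :=
      hf.continuousOn _ (by simp)
    exact ContinuousWithinAt.comp (f := fun s : ℝ => (x, γ x + s)) (x := 0) h1
      hc.continuousWithinAt fun s hs => by
        have : 0 ≤ s := hs
        simpa using this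
  · intro s hs
    have h1 : HasDerivAt (fun s : ℝ => (x, γ x + s)) ((0 : Vec n), (1 : ℝ)) s :=
      (hasDerivAt_const s x).prodMk ((hasDerivAt_id s).const_add (γ x))
    exact (hf.differentiableAt hγ x hs).hasFDerivAt.comp_hasDerivAt s h1
  · refine integrableOn_of_bounded_of_eq_zero (t := Ioc 0 R)
      ((measurable_fderiv_apply_const ℝ f _).comp hc.measurable) measurableSet_Ioi
      measure_Ioc_lt_top.ne Ioc_subset_Ioi_self (fun s hs => hM x s hs) measurableSet_Ioc ?_
    rintro s ⟨hs, hn⟩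
    simp [(hR x s (le_of_lt hs) fun h => hn ⟨hs, h.2⟩).2 hs]
  · refine tendsto_const_nhds.congr' ?_
    filter_upwards [eventually_gt_atTop R] with s hs
    exact ((hR x s (hR0.trans hs.le) fun h => absurd h.2 (not_le.2 hs)).1).symm

/-- Gauss' formula above a Lipschitz graph, in a constant direction `(v, c)`. -/
theorem integral_fderiv (hf : IsGaussAbove γ f) {C : ℝ≥0} (hγ : LipschitzWith C γ) (v : Vec n)
    (c : ℝ) :
    IntegrableOn (fun z => fderiv ℝ f z (v, c)) {z | γ z.1 < z.2} ∧
    Integrable (fun x => f (x, γ x) * (fderiv ℝ γ x v - c)) ∧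
    ∫ z in {z | γ z.1 < z.2}, fderiv ℝ f z (v, c)
      = ∫ x, f (x, γ x) * (fderiv ℝ γ x v - c) := by
  have hγc := hγ.continuous
  have hpre : graphShear γ ⁻¹' {z | γ z.1 < z.2} = univ ×ˢ Ioi (0 : ℝ) := by
    ext z; simp [graphShear]
  have hmp := measurePreserving_graphShear hγc
  have hemb := measurableEmbedding_graphShear hγc
  have ham : Measurable fun x => fderiv ℝ γ x v := measurable_fderiv_apply_const ℝ γ v
  have hab : ∀ x, ‖fderiv ℝ γ x v‖ ≤ C * ‖v‖ := fun x =>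
    ((fderiv ℝ γ x).le_opNorm v).trans (by gcongr; exact norm_fderiv_le_of_lipschitz ℝ hγ)
  have hA := hf.integrableOn_shear hγc (v, 0) (a := fun _ => 1) measurable_const (A := 1) (by simp)
  have hB := hf.integrableOn_shear hγc (0, 1) ham hab
  have hD := hf.integrableOn_shear hγc (0, 1) (a := fun x => c - fderiv ℝ γ x v)
    (measurable_const.sub ham) (A := ‖c‖ + C * ‖v‖)
    (fun x => (norm_sub_le _ _).trans (by gcongr; exact hab x))
  simp only [one_mul] at hA
  -- The direction `(v, c)` is the vector `(v, ∂ᵥγ)`, tangent to the translated graph, plus `c -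
  -- ∂ᵥγ` times the vertical unit vector. The first part integrates to zero over slices, the second
  -- is integrated along vertical rays.
  have hsplit : ∀ z : Vec n × ℝ, fderiv ℝ f (graphShear γ z) (v, c)
      = (fderiv ℝ f (z.1, γ z.1 + z.2) (v, 0)
          + fderiv ℝ γ z.1 v * fderiv ℝ f (z.1, γ z.1 + z.2) (0, 1))
        + (c - fderiv ℝ γ z.1 v) * fderiv ℝ f (z.1, γ z.1 + z.2) (0, 1) := by
    intro z
    have : (v, c) = (v, (0 : ℝ)) + c • ((0 : Vec n), (1 : ℝ)) := by simp
    rw [this, map_add, map_smul, smul_eq_mul, graphShear]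
    ring
  have hint : IntegrableOn (fun z => fderiv ℝ f (graphShear γ z) (v, c)) (univ ×ˢ Ioi (0 : ℝ)) := by
    simp only [hsplit]
    exact (hA.add hB).add hD
  have hprod : (volume : Measure (Vec n × ℝ)).restrict (univ ×ˢ Ioi (0 : ℝ))
      = (volume : Measure (Vec n)).prod (volume.restrict (Ioi (0 : ℝ))) := by
    rw [Measure.volume_eq_prod, ← Measure.prod_restrict, Measure.restrict_univ]
  refine ⟨?_, ?_, ?_⟩
  · rw [← hpre] at hint
    exact (hmp.integrableOn_comp_preimage hemb).1 hint
  · have h1 := hD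
    rw [IntegrableOn, hprod] at h1
    refine h1.integral_prod_left.congr (Eventually.of_forall fun x => ?_)
    simp only
    rw [integral_const_mul, hf.integral_vertical hγc x]
    ring
  · rw [← hmp.setIntegral_preimage_emb hemb, hpre]
    simp only [hsplit]
    have hAB : IntegrableOn (fun z : Vec n × ℝ => fderiv ℝ f (z.1, γ z.1 + z.2) (v, 0)
        + fderiv ℝ γ z.1 v * fderiv ℝ f (z.1, γ z.1 + z.2) (0, 1)) (univ ×ˢ Ioi (0 : ℝ)) :=
      hA.add hB
    rw [IntegrableOn, hprod] at hAB hD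
    rw [hprod, integral_add hAB hD]
    have e1 : ∫ z, (fderiv ℝ f (z.1, γ z.1 + z.2) (v, 0)
          + fderiv ℝ γ z.1 v * fderiv ℝ f (z.1, γ z.1 + z.2) (0, 1))
          ∂((volume : Measure (Vec n)).prod (volume.restrict (Ioi (0 : ℝ)))) = 0 := by
      rw [integral_prod_symm _ hAB]
      refine setIntegral_eq_zero_of_forall_eq_zero fun s hs => ?_
      exact hf.integral_slice_eq_zero hγ hs v
    rw [e1, zero_add, integral_prod _ hD]
    refine integral_congr_ae (Eventually.of_forall fun x => ?_)
    simp only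
    rw [integral_const_mul, hf.integral_vertical hγc x]
    ring

end IsGaussAbove

end GraphGauss

/-! ### Gauss' formula in a boundary chart: surface measure and normal. -/

section LocalGauss

/-- `D` is the region above the graph of the Lipschitz function `γ` inside the open set `U`, in the
orthonormal coordinates `e`. -/
structure IsGraphChart {d : ℕ} (D U : Set (Vec d))
    (e : Vec d ≃ₗᵢ[ℝ] WithLp 2 (Vec (d - 1) × ℝ)) (γ : Vec (d - 1) → ℝ) (K : ℝ≥0) : Prop where
  isOpen : IsOpen U
  lipschitz : LipschitzWith K γ
  mem_iff : ∀ x ∈ U, x ∈ D ↔ γ (e x).fst < (e x).snd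

variable {d : ℕ}

/-- The coordinates of a chart as a continuous linear equivalence. -/
def chartEquiv (e : Vec d ≃ₗᵢ[ℝ] WithLp 2 (Vec (d - 1) × ℝ)) : (Vec (d - 1) × ℝ) ≃L[ℝ] Vec d :=
  (WithLp.prodContinuousLinearEquiv 2 ℝ (Vec (d - 1)) ℝ).symm.trans
    e.symm.toContinuousLinearEquiv

theorem chartEquiv_apply (e : Vec d ≃ₗᵢ[ℝ] WithLp 2 (Vec (d - 1) × ℝ)) (z : Vec (d - 1) × ℝ) :
    chartEquiv e z = e.symm (WithLp.toLp 2 z) := rfl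

theorem apply_chartEquiv (e : Vec d ≃ₗᵢ[ℝ] WithLp 2 (Vec (d - 1) × ℝ)) (z : Vec (d - 1) × ℝ) :
    e (chartEquiv e z) = WithLp.toLp 2 z := by
  rw [chartEquiv_apply, LinearIsometryEquiv.apply_symm_apply]

theorem measurePreserving_chartEquiv (e : Vec d ≃ₗᵢ[ℝ] WithLp 2 (Vec (d - 1) × ℝ)) :
    MeasurePreserving (chartEquiv e) :=
  e.symm.measurePreserving.comp (WithLp.volume_preserving_toLp (Vec (d - 1)) ℝ)

theorem measurableEmbedding_chartEquiv (e : Vec d ≃ₗᵢ[ℝ] WithLp 2 (Vec (d - 1) × ℝ)) :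
    MeasurableEmbedding (chartEquiv e) :=
  (chartEquiv e).toHomeomorph.measurableEmbedding

/-- The parametrization of the boundary in a chart. -/
def boundaryMap (e : Vec d ≃ₗᵢ[ℝ] WithLp 2 (Vec (d - 1) × ℝ)) (γ : Vec (d - 1) → ℝ)
    (x : Vec (d - 1)) : Vec d := chartEquiv e (x, γ x)

variable {D U : Set (Vec d)} {e : Vec d ≃ₗᵢ[ℝ] WithLp 2 (Vec (d - 1) × ℝ)}
  {γ : Vec (d - 1) → ℝ} {K : ℝ≥0}

theorem measurableEmbedding_boundaryMap (hγ : Continuous γ) :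
    MeasurableEmbedding (boundaryMap e γ) :=
  (measurableEmbedding_chartEquiv e).comp
    ((continuous_id.prodMk hγ).measurableEmbedding fun _ _ h => (Prod.mk.inj h).1)

/-- The area formula carried to `Vec d` by the isometry `e.symm`, which preserves Hausdorff measure.
-/
theorem map_boundaryMap_graphMeasure (hγ : LipschitzWith K γ) :
    Measure.map (boundaryMap e γ) (graphMeasure γ)
      = Measure.restrict μHE[d - 1] (range (boundaryMap e γ)) := by
  have hemb := measurableEmbedding_boundaryMap (e := e) hγ.continuous
  rw [← hemb.map_comap]
  congr 1
  rw [← comap_graphMap_euclideanHausdorffMeasure hγ]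
  ext s hs
  rw [hemb.comap_apply, (measurableEmbedding_graphMap hγ.continuous).comap_apply,
    ← e.symm.isometry.euclideanHausdorffMeasure_image, image_image]
  rfl

namespace IsGraphChart

theorem mem_iff_lt (h : IsGraphChart D U e γ K) {z : Vec (d - 1) × ℝ} (hz : chartEquiv e z ∈ U) :
    chartEquiv e z ∈ D ↔ γ z.1 < z.2 := by
  rw [h.mem_iff _ hz, apply_chartEquiv]
  rfl

theorem mem_closure_iff (h : IsGraphChart D U e γ K) {z : Vec (d - 1) × ℝ}
    (hz : chartEquiv e z ∈ U) : chartEquiv e z ∈ closure D ↔ γ z.1 ≤ z.2 := by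
  have hγ := h.lipschitz.continuous
  constructor
  · intro hcl
    by_contra! hlt
    have hopen : IsOpen {y : Vec (d - 1) × ℝ | y.2 < γ y.1} :=
      isOpen_lt continuous_snd (hγ.comp continuous_fst)
    have hev : ∀ᶠ x in 𝓝 (chartEquiv e z), x ∈ U ∧ x ∉ D := by
      have h1 : ∀ᶠ x in 𝓝 (chartEquiv e z), ((chartEquiv e).symm x) ∈ {y | y.2 < γ y.1} :=
        (chartEquiv e).symm.continuous.continuousAt.eventually
          (hopen.mem_nhds (by simpa using hlt))
      filter_upwards [h1, h.isOpen.mem_nhds hz] with x hx1 hx2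
      refine ⟨hx2, fun hxD => ?_⟩
      exact absurd ((h.mem_iff x hx2).1 hxD) (not_lt.2 (le_of_lt hx1))
    obtain ⟨x, hx, hxD⟩ := mem_closure_iff_nhds.1 hcl _ hev
    exact hx.2 hxD
  · intro hle
    have hlim : Tendsto (fun s : ℝ => chartEquiv e (z.1, z.2 + s)) (𝓝[>] 0)
        (𝓝 (chartEquiv e z)) := by
      have hc : Continuous fun s : ℝ => chartEquiv e (z.1, z.2 + s) := by fun_prop
      have := hc.tendsto 0
      rw [add_zero] at this
      exact this.mono_left nhdsWithin_le_nhds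
    refine mem_closure_of_tendsto hlim ?_
    filter_upwards [hlim.eventually (h.isOpen.mem_nhds hz), self_mem_nhdsWithin] with s hs hs0
    have : (0 : ℝ) < s := hs0
    rw [h.mem_iff_lt hs]
    simp only
    linarith

theorem mem_frontier_iff (h : IsGraphChart D U e γ K) (hD : IsOpen D) {z : Vec (d - 1) × ℝ}
    (hz : chartEquiv e z ∈ U) : chartEquiv e z ∈ frontier D ↔ γ z.1 = z.2 := by
  rw [hD.frontier_eq, Set.mem_sdiff, h.mem_closure_iff hz, h.mem_iff_lt hz, not_lt, le_antisymm_iff]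

theorem frontier_inter_eq (h : IsGraphChart D U e γ K) (hD : IsOpen D) :
    frontier D ∩ U = range (boundaryMap e γ) ∩ U := by
  ext x
  obtain ⟨z, rfl⟩ := (chartEquiv e).surjective x
  simp only [mem_inter_iff, and_congr_left_iff]
  intro hz
  rw [h.mem_frontier_iff hD hz]
  constructor
  · exact fun h => ⟨z.1, by rw [boundaryMap, h]⟩
  · rintro ⟨y, hy⟩
    have := (chartEquiv e).injective hy
    rw [← this]

/-- Surface integrals of functions supported in a chart. -/
theorem integrable_surfaceMeasure_iff (h : IsGraphChart D U e γ K) (hD : IsOpen D)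
    {g : Vec d → ℝ} (hg : ∀ x ∉ U, g x = 0) :
    (Integrable g (surfaceMeasure D) ↔
      Integrable fun x => graphJacobian (fderiv ℝ γ x) * g (boundaryMap e γ x)) ∧
    ∫ x, g x ∂(surfaceMeasure D)
      = ∫ x, graphJacobian (fderiv ℝ γ x) * g (boundaryMap e γ x) := by
  have hemb := measurableEmbedding_boundaryMap (e := e) h.lipschitz.continuous
  have hUm := h.isOpen.measurableSet
  have hfm : MeasurableSet (frontier D) := isClosed_frontier.measurableSet
  have hJ : Measurable fun x => (graphJacobian (fderiv ℝ γ x)).toNNReal :=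
    (continuous_graphJacobian.measurable.comp (measurable_fderiv ℝ γ)).real_toNNReal
  have hdens : graphMeasure γ
      = volume.withDensity fun x => ((graphJacobian (fderiv ℝ γ x)).toNNReal : ENNReal) := rfl
  have hcoe : ∀ x, ((graphJacobian (fderiv ℝ γ x)).toNNReal : ℝ) = graphJacobian (fderiv ℝ γ x) :=
    fun x => Real.coe_toNNReal _ (zero_le_one.trans (one_le_graphJacobian _))
  -- Since `g` vanishes off `U`, both the frontier and the whole graph may be cut down to `U`, where
  -- they coincide.
  have hset : ∀ s : Set (Vec d), MeasurableSet s →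
      (IntegrableOn g s μHE[d - 1] ↔ IntegrableOn g (s ∩ U) μHE[d - 1]) ∧
      ∫ x in s, g x ∂μHE[d - 1] = ∫ x in s ∩ U, g x ∂μHE[d - 1] := by
    intro s hs
    have h0 : ∀ x ∈ s \ (s ∩ U), g x = 0 := fun x hx => hg x fun hxU => hx.2 ⟨hx.1, hxU⟩
    exact ⟨⟨fun hi => hi.mono_set inter_subset_left, fun hi => hi.of_forall_sdiff_eq_zero hs h0⟩,
      setIntegral_eq_of_subset_of_forall_sdiff_eq_zero hs inter_subset_left h0⟩
  have h1 := hset _ hfm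
  have h2 := hset _ hemb.measurableSet_range
  rw [h.frontier_inter_eq hD] at h1
  constructor
  · rw [surfaceMeasure, ← IntegrableOn, h1.1, ← h2.1, IntegrableOn,
      ← map_boundaryMap_graphMeasure h.lipschitz, hemb.integrable_map_iff, hdens,
      integrable_withDensity_iff_integrable_smul hJ]
    simp only [NNReal.smul_def, hcoe, Function.comp_apply, smul_eq_mul]
  · rw [surfaceMeasure, h1.2, ← h2.2, ← map_boundaryMap_graphMeasure h.lipschitz,
      hemb.integral_map, hdens, integral_withDensity_eq_integral_smul hJ]
    simp only [NNReal.smul_def, hcoe, smul_eq_mul]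

/-- The outward normal at a boundary point where the graph is differentiable. -/
theorem isOutwardNormal (h : IsGraphChart D U e γ K) {x : Vec (d - 1)}
    (hx : boundaryMap e γ x ∈ U) (hd : DifferentiableAt ℝ γ x) :
    IsOutwardNormal D (boundaryMap e γ x)
      ((graphJacobian (fderiv ℝ γ x))⁻¹ • chartEquiv e (gradient γ x, -1)) := by
  set a := fderiv ℝ γ x with ha
  have hJ1 := one_le_graphJacobian a
  have hJ0 : 0 < graphJacobian a := by linarith
  have hgrad : ∀ w, inner ℝ w (gradient γ x) = a w := fun w => by
    rw [real_inner_comm, gradient, InnerProductSpace.toDual_symm_apply]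
  have hinner : ∀ z : Vec (d - 1) × ℝ,
      inner ℝ (chartEquiv e z) (chartEquiv e (gradient γ x, -1)) = a z.1 - z.2 := by
    intro z
    rw [chartEquiv_apply, chartEquiv_apply, LinearIsometryEquiv.inner_map_map,
      WithLp.prod_inner_apply]
    simp only [hgrad]
    simp [sub_eq_add_neg]
  have hnorm : ‖chartEquiv e (gradient γ x, -1)‖ = graphJacobian a := by
    rw [chartEquiv_apply, LinearIsometryEquiv.norm_map, WithLp.prod_norm_eq_of_L2, graphJacobian]
    congr 1
    have e1 : ‖(WithLp.toLp 2 (gradient γ x, (-1 : ℝ))).fst‖ = ‖a‖ := by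
      change ‖gradient γ x‖ = ‖a‖
      rw [gradient, LinearIsometryEquiv.norm_map]
    have e2 : ‖(WithLp.toLp 2 (gradient γ x, (-1 : ℝ))).snd‖ = 1 := by
      change ‖(-1 : ℝ)‖ = 1
      norm_num
    rw [e1, e2]
    ring
  -- Differentiability of `γ` at `x`, with the error measured against the full distance rather than
  -- its horizontal part.
  have hlittle : ∀ ε > 0, ∀ᶠ y in 𝓝 (boundaryMap e γ x),
      |γ ((chartEquiv e).symm y).1 - γ x - a (((chartEquiv e).symm y).1 - x)|
        ≤ ε * ‖y - boundaryMap e γ x‖ := by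
    intro ε hε
    have hc : Tendsto (fun y => ((chartEquiv e).symm y).1) (𝓝 (boundaryMap e γ x)) (𝓝 x) := by
      have : Continuous fun y => ((chartEquiv e).symm y).1 :=
        continuous_fst.comp (chartEquiv e).symm.continuous
      have h2 := this.tendsto (boundaryMap e γ x)
      simpa [boundaryMap] using h2
    have := hc.eventually (hd.hasFDerivAt.isLittleO.bound hε)
    filter_upwards [this] with y hy
    refine hy.trans ?_
    gcongr
    have e1 : ((chartEquiv e).symm y).1 - x
        = (e (y - boundaryMap e γ x)).fst := by
      rw [map_sub, boundaryMap, apply_chartEquiv]; rfl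
    rw [e1, ← e.norm_map (y - boundaryMap e γ x), WithLp.prod_norm_eq_of_L2]
    exact Real.le_sqrt_of_sq_le (by nlinarith [sq_nonneg ‖(e (y - boundaryMap e γ x)).snd‖])
  have hval : ∀ y, inner ℝ (y - boundaryMap e γ x)
      ((graphJacobian a)⁻¹ • chartEquiv e (gradient γ x, -1))
      = (graphJacobian a)⁻¹ * (a (((chartEquiv e).symm y).1 - x)
          - (((chartEquiv e).symm y).2 - γ x)) := by
    intro y
    obtain ⟨z, rfl⟩ := (chartEquiv e).surjective y
    rw [inner_smul_right, boundaryMap, ← map_sub, hinner]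
    simp
  -- The Jacobian is at least 1, so normalizing the vector `(∇γ, -1)` does not enlarge the error.
  have hscale : ∀ ε > 0, ∀ r, 0 ≤ r → (graphJacobian a)⁻¹ * (ε * r) ≤ ε * r := fun ε hε r hr =>
    mul_le_of_le_one_left (by positivity) (inv_le_one_of_one_le₀ hJ1)
  refine ⟨?_, fun ε hε => ?_, fun ε hε => ?_⟩
  · rw [norm_smul, hnorm, norm_inv, Real.norm_eq_abs, abs_of_pos hJ0, inv_mul_cancel₀ hJ0.ne']
  · filter_upwards [hlittle ε hε, h.isOpen.mem_nhds hx] with y hy hyU hyD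
    have h1 : γ ((chartEquiv e).symm y).1 < ((chartEquiv e).symm y).2 := (h.mem_iff y hyU).1 hyD
    rw [hval]
    refine le_trans ?_ (hscale ε hε _ (norm_nonneg _))
    gcongr
    have := (abs_le.1 hy).1
    linarith
  · filter_upwards [hlittle ε hε, h.isOpen.mem_nhds hx] with y hy hyU hyD
    have h1 : ((chartEquiv e).symm y).2 ≤ γ ((chartEquiv e).symm y).1 :=
      not_lt.1 fun hlt => hyD ((h.mem_iff y hyU).2 hlt)
    rw [hval]
    refine le_trans (neg_le_neg (hscale ε hε _ (norm_nonneg _))) ?_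
    rw [← mul_neg]
    gcongr
    have := (abs_le.1 hy).2
    linarith

end IsGraphChart

theorem IsOutwardNormal.outwardNormal_eq {x ν : Vec d} (h : IsOutwardNormal D x ν) :
    outwardNormal D x = ν := by
  have hex : ∃ ν, IsOutwardNormal D x ν := ⟨ν, h⟩
  rw [outwardNormal, dif_pos hex]
  exact hex.choose_spec.unique h

/-- The Jacobian of the surface element cancels the normalization of `(∇γ, -1)`, leaving exactly the
boundary weight of `IsGaussAbove.integral_fderiv`. -/
theorem IsGraphChart.jacobian_mul_inner_outwardNormal (h : IsGraphChart D U e γ K)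
    {x : Vec (d - 1)} (hx : boundaryMap e γ x ∈ U) (hd : DifferentiableAt ℝ γ x) (v : Vec d) :
    graphJacobian (fderiv ℝ γ x) * inner ℝ v (outwardNormal D (boundaryMap e γ x))
      = fderiv ℝ γ x ((chartEquiv e).symm v).1 - ((chartEquiv e).symm v).2 := by
  obtain ⟨z, rfl⟩ := (chartEquiv e).surjective v
  have hJ0 : graphJacobian (fderiv ℝ γ x) ≠ 0 := by
    linarith [one_le_graphJacobian (fderiv ℝ γ x)]
  rw [(h.isOutwardNormal hx hd).outwardNormal_eq, inner_smul_right, mul_inv_cancel_left₀ hJ0,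
    chartEquiv_apply, chartEquiv_apply, LinearIsometryEquiv.inner_map_map,
    WithLp.prod_inner_apply, ← chartEquiv_apply, ContinuousLinearEquiv.symm_apply_apply]
  have hgrad : inner ℝ z.1 (gradient γ x) = fderiv ℝ γ x z.1 := by
    rw [real_inner_comm, gradient, InnerProductSpace.toDual_symm_apply]
  simp only [hgrad]
  simp [sub_eq_add_neg]

/-- Functions for which the Gauss formula is proved: continuous up to the boundary, with continuous
bounded derivative inside. -/
structure IsGaussRegular (D : Set (Vec d)) (F : Vec d → ℝ) : Prop where
  continuousOn : ContinuousOn F (closure D)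
  contDiffOn : ContDiffOn ℝ 1 F D
  exists_bound : ∃ B, ∀ x ∈ D, ‖fderiv ℝ F x‖ ≤ B

/-- The Gauss formula for `F` in all constant directions. -/
def GaussFormula (D : Set (Vec d)) (F : Vec d → ℝ) : Prop :=
  ∀ v : Vec d, IntegrableOn (fun x => fderiv ℝ F x v) D ∧
    Integrable (fun x => F x * inner ℝ v (outwardNormal D x)) (surfaceMeasure D) ∧
    ∫ x in D, fderiv ℝ F x v = ∫ x, F x * inner ℝ v (outwardNormal D x) ∂(surfaceMeasure D)

/-- A point above the graph either lies in `U`, where it corresponds to a point of `D`, or has a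
neighbourhood on which `F` vanishes. Hence regularity on `D` passes to the whole region above the
graph. -/
theorem IsGaussRegular.isGaussAbove {F : Vec d → ℝ} (hF : IsGaussRegular D F) (hD : IsOpen D)
    (hDb : Bornology.IsBounded D) (h : IsGraphChart D U e γ K) (hU : tsupport F ⊆ U) :
    IsGaussAbove γ (F ∘ chartEquiv e) := by
  have hzero : ∀ x ∉ U, F =ᶠ[𝓝 x] 0 := fun x hx =>
    notMem_tsupport_iff_eventuallyEq.1 fun hx' => hx (hU hx')
  have hcd : ∀ z : Vec (d - 1) × ℝ, γ z.1 < z.2 → ContDiffAt ℝ 1 F (chartEquiv e z) := by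
    intro z hz
    by_cases hzU : chartEquiv e z ∈ U
    · exact hF.contDiffOn.contDiffAt (hD.mem_nhds ((h.mem_iff_lt hzU).2 hz))
    · exact contDiffAt_const.congr_of_eventuallyEq (hzero _ hzU)
  have hfd : ∀ z : Vec (d - 1) × ℝ, γ z.1 < z.2 → fderiv ℝ (F ∘ chartEquiv e) z
      = (fderiv ℝ F (chartEquiv e z)).comp (chartEquiv e : Vec (d - 1) × ℝ →L[ℝ] Vec d) :=
    fun z hz => (((hcd z hz).differentiableAt one_ne_zero).hasFDerivAt.comp z
      (chartEquiv e).hasFDerivAt).fderiv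
  refine ⟨fun z hz => ?_, fun z hz => ?_, ?_, ?_⟩
  · have hz : γ z.1 ≤ z.2 := hz
    by_cases hzU : chartEquiv e z ∈ U
    · have h1 := hF.continuousOn _ ((h.mem_closure_iff hzU).2 hz)
      have h2 : ContinuousWithinAt F (closure D ∩ U) (chartEquiv e z) := h1.mono inter_subset_left
      have h3 : ContinuousWithinAt (F ∘ chartEquiv e)
          ({z | γ z.1 ≤ z.2} ∩ chartEquiv e ⁻¹' U) z :=
        h2.comp (chartEquiv e).continuous.continuousWithinAt fun y hy =>
          ⟨(h.mem_closure_iff hy.2).2 hy.1, hy.2⟩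
      exact (continuousWithinAt_inter ((chartEquiv e).continuous.continuousAt.preimage_mem_nhds
        (h.isOpen.mem_nhds hzU))).1 h3
    · have h1 : ContinuousAt F (chartEquiv e z) :=
        (continuousAt_const (y := (0 : ℝ))).congr (hzero _ hzU).symm
      exact (ContinuousAt.comp h1 (chartEquiv e).continuous.continuousAt).continuousWithinAt
  · exact ((hcd z hz).comp z (chartEquiv e).contDiff.contDiffAt).contDiffWithinAt
  · obtain ⟨B, hB⟩ := hF.exists_bound
    refine ⟨|B| * ‖(chartEquiv e : Vec (d - 1) × ℝ →L[ℝ] Vec d)‖, fun z hz => ?_⟩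
    rw [hfd z hz]
    refine (ContinuousLinearMap.opNorm_comp_le _ _).trans ?_
    gcongr
    by_cases hzU : chartEquiv e z ∈ U
    · exact (hB _ ((h.mem_iff_lt hzU).2 hz)).trans (le_abs_self B)
    · rw [(hzero _ hzU).fderiv_eq]
      simp
  · obtain ⟨R, hR⟩ := ((chartEquiv e).symm.lipschitz.isBounded_image
      hDb.closure).exists_norm_le
    refine ⟨R, fun z hz hzR => ?_⟩
    by_cases hzU : chartEquiv e z ∈ U
    · have := hR z ⟨_, (h.mem_closure_iff hzU).2 hz, by simp⟩
      linarith
    · exact (hzero _ hzU).eq_of_nhds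

theorem IsGaussRegular.gaussFormula_of_chart {F : Vec d → ℝ} (hF : IsGaussRegular D F)
    (hD : IsOpen D) (hDb : Bornology.IsBounded D) (h : IsGraphChart D U e γ K)
    (hU : tsupport F ⊆ U) : GaussFormula D F := by
  intro v
  have hA := hF.isGaussAbove hD hDb h hU
  have hzero : ∀ x ∉ U, F =ᶠ[𝓝 x] 0 := fun x hx =>
    notMem_tsupport_iff_eventuallyEq.1 fun hx' => hx (hU hx')
  have hF0 : ∀ x ∉ U, F x = 0 := fun x hx => (hzero x hx).eq_of_nhds
  have hF0' : ∀ x ∉ U, fderiv ℝ F x v = 0 := fun x hx => by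
    rw [(hzero x hx).fderiv_eq]; simp
  obtain ⟨i1, i2, i3⟩ := hA.integral_fderiv h.lipschitz ((chartEquiv e).symm v).1
    ((chartEquiv e).symm v).2
  set Ep : Set (Vec (d - 1) × ℝ) := {z | γ z.1 < z.2} with hEp
  have hEpo : IsOpen Ep := isOpen_above h.lipschitz.continuous
  have hfd : ∀ z, fderiv ℝ (F ∘ chartEquiv e) z
      (((chartEquiv e).symm v).1, ((chartEquiv e).symm v).2) = fderiv ℝ F (chartEquiv e z) v := by
    intro z
    rw [(chartEquiv e).comp_right_fderiv]
    simp
  simp only [hfd] at i1 i3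
  have hmp := measurePreserving_chartEquiv e
  have hemb := measurableEmbedding_chartEquiv e
  set V : Set (Vec d) := (chartEquiv e).symm ⁻¹' Ep with hV
  have hVm : MeasurableSet V := (hEpo.preimage (chartEquiv e).symm.continuous).measurableSet
  have hpre : chartEquiv e ⁻¹' V = Ep := by ext z; simp [hV]
  have hVD : V ∩ U = D ∩ U := by
    ext x
    simp only [mem_inter_iff, and_congr_left_iff]
    exact fun hx => (h.mem_iff x hx).symm
  have hset : ∀ s : Set (Vec d), MeasurableSet s →
      (IntegrableOn (fun x => fderiv ℝ F x v) s ↔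
        IntegrableOn (fun x => fderiv ℝ F x v) (s ∩ U)) ∧
      ∫ x in s, fderiv ℝ F x v = ∫ x in s ∩ U, fderiv ℝ F x v := by
    intro s hs
    have h0 : ∀ x ∈ s \ (s ∩ U), fderiv ℝ F x v = 0 :=
      fun x hx => hF0' x fun hxU => hx.2 ⟨hx.1, hxU⟩
    exact ⟨⟨fun hi => hi.mono_set inter_subset_left, fun hi => hi.of_forall_sdiff_eq_zero hs h0⟩,
      setIntegral_eq_of_subset_of_forall_sdiff_eq_zero hs inter_subset_left h0⟩
  have hsD := hset D hD.measurableSet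
  have hsV := hset V hVm
  rw [hVD] at hsV
  have i1' : IntegrableOn (fun x => fderiv ℝ F x v) V := by
    rw [← hpre] at i1
    exact (hmp.integrableOn_comp_preimage hemb).1 i1
  have i3' : ∫ x in V, fderiv ℝ F x v = ∫ z in Ep, fderiv ℝ F (chartEquiv e z) v := by
    rw [← hpre, hmp.setIntegral_preimage_emb hemb (fun x => fderiv ℝ F x v)]
  have hsurf := h.integrable_surfaceMeasure_iff hD
    (g := fun x => F x * inner ℝ v (outwardNormal D x)) (fun x hx => by simp [hF0 x hx])
  have hae : (fun x => graphJacobian (fderiv ℝ γ x) * (F (boundaryMap e γ x) *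
        inner ℝ v (outwardNormal D (boundaryMap e γ x)))) =ᵐ[volume]
      fun x => (F ∘ chartEquiv e) (x, γ x) *
        (fderiv ℝ γ x ((chartEquiv e).symm v).1 - ((chartEquiv e).symm v).2) := by
    filter_upwards [h.lipschitz.ae_differentiableAt] with x hx
    by_cases hxU : boundaryMap e γ x ∈ U
    · rw [← h.jacobian_mul_inner_outwardNormal hxU hx]
      simp only [Function.comp_apply, boundaryMap]
      ring
    · have : (F ∘ chartEquiv e) (x, γ x) = 0 := hF0 _ hxU
      rw [hF0 _ hxU, this]
      ring
  refine ⟨hsD.1.2 (hsV.1.1 i1'), hsurf.1.2 (i2.congr hae.symm), ?_⟩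
  rw [hsD.2, ← hsV.2, i3', i3, hsurf.2, integral_congr_ae hae]

end LocalGauss

/-! ### The divergence theorem on bounded Lipschitz domains. -/

section GlobalGauss

variable {d : ℕ} {D : Set (Vec d)}

namespace IsGaussRegular

variable {F G : Vec d → ℝ}

theorem differentiableAt (hF : IsGaussRegular D F) (hD : IsOpen D) {x : Vec d} (hx : x ∈ D) :
    DifferentiableAt ℝ F x :=
  (hF.contDiffOn.contDiffAt (hD.mem_nhds hx)).differentiableAt one_ne_zero

theorem mul_left (hF : IsGaussRegular D F) (hD : IsOpen D) (hDb : Bornology.IsBounded D)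
    {b : Vec d → ℝ} (hb : ContDiff ℝ 1 b) : IsGaussRegular D (fun x => b x * F x) := by
  have hc : IsCompact (closure D) := hDb.isCompact_closure
  refine ⟨hb.continuous.continuousOn.mul hF.continuousOn, hb.contDiffOn.mul hF.contDiffOn, ?_⟩
  obtain ⟨B, hB⟩ := hF.exists_bound
  obtain ⟨M, hM⟩ := hc.exists_bound_of_continuousOn hF.continuousOn
  obtain ⟨N, hN⟩ := hc.exists_bound_of_continuousOn hb.continuous.continuousOn
  obtain ⟨N', hN'⟩ := hc.exists_bound_of_continuousOn
    (hb.continuous_fderiv one_ne_zero).continuousOn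
  refine ⟨N * B + M * N', fun x hx => ?_⟩
  have hx' := subset_closure hx
  rw [fderiv_fun_mul (hb.differentiable one_ne_zero x) (hF.differentiableAt hD hx)]
  refine (norm_add_le _ _).trans (add_le_add ?_ ?_)
  · rw [norm_smul]
    exact mul_le_mul (hN x hx') (hB x hx) (norm_nonneg _) ((norm_nonneg _).trans (hN x hx'))
  · rw [norm_smul]
    exact mul_le_mul (hM x hx') (hN' x hx') (norm_nonneg _) ((norm_nonneg _).trans (hM x hx'))

/-- The derivative within the closure is continuous on a compact set, hence bounded, and equals the
full derivative inside `D`. -/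
theorem of_contDiffOn_closure (hD : IsOpen D) (hDb : Bornology.IsBounded D)
    (hu : UniqueDiffOn ℝ (closure D)) (hF : ContDiffOn ℝ 1 F (closure D)) :
    IsGaussRegular D F := by
  refine ⟨hF.continuousOn, hF.mono subset_closure, ?_⟩
  obtain ⟨B, hB⟩ := hDb.isCompact_closure.exists_bound_of_continuousOn
    (hF.continuousOn_fderivWithin hu le_rfl)
  refine ⟨B, fun x hx => ?_⟩
  rw [← fderivWithin_of_mem_nhds (mem_of_superset (hD.mem_nhds hx) subset_closure)]
  exact hB x (subset_closure hx)

/-- The Gauss formula for functions supported in the domain. -/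
theorem gaussFormula_of_tsupport_subset (hF : IsGaussRegular D F) (hD : IsOpen D)
    (hDb : Bornology.IsBounded D) (hs : tsupport F ⊆ D) : GaussFormula D F := by
  intro v
  have hzero : ∀ x ∉ D, F =ᶠ[𝓝 x] 0 := fun x hx =>
    notMem_tsupport_iff_eventuallyEq.1 fun hx' => hx (hs hx')
  have hcd : ContDiff ℝ 1 F := contDiff_iff_contDiffAt.2 fun x => by
    by_cases hx : x ∈ D
    · exact hF.contDiffOn.contDiffAt (hD.mem_nhds hx)
    · exact contDiffAt_const.congr_of_eventuallyEq (hzero x hx)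
  have hcs : HasCompactSupport F := hDb.isCompact_closure.of_isClosed_subset
    (isClosed_tsupport F) (hs.trans subset_closure)
  have hsurf : (fun x => F x * inner ℝ v (outwardNormal D x)) =ᵐ[surfaceMeasure D] 0 := by
    refine (ae_restrict_iff' isClosed_frontier.measurableSet).2 (Eventually.of_forall fun x hx => ?_)
    rw [hD.frontier_eq] at hx
    simp [(hzero x hx.2).eq_of_nhds]
  have hvol : ∀ x ∉ D, fderiv ℝ F x v = 0 := fun x hx => by
    rw [(hzero x hx).fderiv_eq]; simp
  refine ⟨?_, (integrable_zero _ _ _).congr hsurf.symm, ?_⟩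
  · exact (((hcd.continuous_fderiv one_ne_zero).clm_apply
      continuous_const).integrable_of_hasCompactSupport (hcs.fderiv_apply ℝ v)).integrableOn
  · rw [setIntegral_eq_integral_of_forall_compl_eq_zero hvol, integral_congr_ae hsurf]
    simp only [Pi.zero_apply, integral_zero]
    rw [← integral_lineDeriv_eq_zero hcd.locallyLipschitz hcs v]
    exact integral_congr_ae (Eventually.of_forall fun x =>
      ((hcd.differentiable one_ne_zero x).lineDeriv_eq_fderiv).symm)

end IsGaussRegular

namespace GaussFormula

variable {F G : Vec d → ℝ}

theorem congr (hF : GaussFormula D F) (hD : IsOpen D) (h : EqOn F G (closure D)) :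
    GaussFormula D G := by
  intro v
  obtain ⟨h1, h2, h3⟩ := hF v
  have e1 : EqOn (fun x => fderiv ℝ F x v) (fun x => fderiv ℝ G x v) D := fun x hx => by
    have : F =ᶠ[𝓝 x] G := by
      filter_upwards [hD.mem_nhds hx] with y hy using h (subset_closure hy)
    simp only [this.fderiv_eq]
  have e2 : (fun x => F x * inner ℝ v (outwardNormal D x)) =ᵐ[surfaceMeasure D]
      fun x => G x * inner ℝ v (outwardNormal D x) :=
    (ae_restrict_iff' isClosed_frontier.measurableSet).2 (Eventually.of_forall fun x hx => by
      simp only [h (frontier_subset_closure hx)])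
  exact ⟨h1.congr_fun e1 hD.measurableSet, h2.congr e2,
    by rw [← setIntegral_congr_fun hD.measurableSet e1, h3, integral_congr_ae e2]⟩

theorem zero : GaussFormula D 0 := by
  intro v
  simp [IntegrableOn]

theorem add (hF : GaussFormula D F) (hG : GaussFormula D G) (hD : IsOpen D)
    (hF' : IsGaussRegular D F) (hG' : IsGaussRegular D G) :
    GaussFormula D (fun x => F x + G x) := by
  intro v
  obtain ⟨f1, f2, f3⟩ := hF v
  obtain ⟨g1, g2, g3⟩ := hG v
  have e1 : EqOn (fun x => fderiv ℝ F x v + fderiv ℝ G x v)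
      (fun x => fderiv ℝ (fun x => F x + G x) x v) D := fun x hx => by
    simp only
    rw [fderiv_fun_add (hF'.differentiableAt hD hx) (hG'.differentiableAt hD hx)]
    rfl
  simp only [add_mul]
  refine ⟨(f1.add g1).congr_fun e1 hD.measurableSet, f2.add g2, ?_⟩
  rw [← setIntegral_congr_fun hD.measurableSet e1, integral_add f1 g1, integral_add f2 g2, f3, g3]

end GaussFormula

theorem IsLipschitzDomain.exists_chart (hD : IsLipschitzDomain D) {x : Vec d}
    (hx : x ∈ frontier D) : ∃ U e γ K, IsGraphChart D U e γ K ∧ x ∈ U := by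
  obtain ⟨U, e, γ, K, h1, h2, h3, h4⟩ := hD.exists_graph x hx
  exact ⟨U, e, γ, K, ⟨h1, h3, h4⟩, h2⟩

theorem IsLipschitzDomain.exists_local_gauss (hD : IsLipschitzDomain D) {x : Vec d}
    (hx : x ∈ closure D) : ∃ U ∈ 𝓝 x, ∀ F : Vec d → ℝ, IsGaussRegular D F → tsupport F ⊆ U →
      GaussFormula D F := by
  by_cases hxD : x ∈ D
  · exact ⟨D, hD.isOpen.mem_nhds hxD, fun F hF hs =>
      hF.gaussFormula_of_tsupport_subset hD.isOpen hD.isBounded hs⟩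
  · have hf : x ∈ frontier D := by
      rw [hD.isOpen.frontier_eq]
      exact ⟨hx, hxD⟩
    obtain ⟨U, e, γ, K, h, hxU⟩ := hD.exists_chart hf
    exact ⟨U, h.isOpen.mem_nhds hxU, fun F hF hs =>
      hF.gaussFormula_of_chart hD.isOpen hD.isBounded h hs⟩

/-- Localization without a partition of unity: bump functions equal to 1 on a finite cover of the
closure are peeled off one at a time through `F = b F + (1 - b) F`. -/
theorem IsLipschitzDomain.gaussFormula (hD : IsLipschitzDomain D) {F : Vec d → ℝ}
    (hF : IsGaussRegular D F) : GaussFormula D F := by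
  have hbump : ∀ x : Vec d, ∃ (b : Vec d → ℝ) (V : Set (Vec d)), x ∈ closure D →
      (ContDiff ℝ 1 b ∧ V ∈ 𝓝 x ∧ (∀ y ∈ V, b y = 1) ∧
        ∀ F : Vec d → ℝ, IsGaussRegular D F → GaussFormula D (fun y => b y * F y)) := by
    intro x
    by_cases hx : x ∈ closure D
    · obtain ⟨U, hU, hloc⟩ := hD.exists_local_gauss hx
      obtain ⟨r, hr, hrU⟩ := Metric.nhds_basis_closedBall.mem_iff.1 hU
      let b : ContDiffBump x := ⟨r / 2, r, half_pos hr, half_lt_self hr⟩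
      refine ⟨b, Metric.closedBall x (r / 2), fun _ => ⟨b.contDiff,
        Metric.closedBall_mem_nhds x (half_pos hr), fun y hy => b.one_of_mem_closedBall hy,
        fun F hF => hloc _ (hF.mul_left hD.isOpen hD.isBounded b.contDiff) ?_⟩⟩
      refine (tsupport_mul_subset_left (f := b) (g := F)).trans ?_
      rw [b.tsupport_eq]
      exact hrU
    · exact ⟨0, ∅, fun h => absurd h hx⟩
  choose b V hbV using hbump
  obtain ⟨t, ht, hcov⟩ := hD.isBounded.isCompact_closure.elim_nhds_subcover V
    fun x hx => (hbV x hx).2.1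
  -- The induction quantifies over `F`, since the remainder `(1 - b) F` takes its place. The
  -- vanishing product says that nothing is left on the closure once all the bumps in `t` are used.
  have key : ∀ t : Finset (Vec d), (∀ x ∈ t, x ∈ closure D) → ∀ F : Vec d → ℝ,
      IsGaussRegular D F → (∀ y ∈ closure D, F y * ∏ x ∈ t, (1 - b x y) = 0) →
      GaussFormula D F := by
    classical
    intro t
    induction t using Finset.induction_on with
    | empty =>
      intro _ F _ h0
      exact GaussFormula.zero.congr hD.isOpen fun y hy => by simpa using (h0 y hy).symm
    | insert x t hxt ih =>
      intro ht F hF h0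
      have hx := hbV x (ht x (Finset.mem_insert_self x t))
      have hb1 : ContDiff ℝ 1 fun y => 1 - b x y := contDiff_const.sub hx.1
      have hF1 := hF.mul_left hD.isOpen hD.isBounded hx.1
      have hF2 := hF.mul_left hD.isOpen hD.isBounded hb1
      have h2 := ih (fun y hy => ht y (Finset.mem_insert_of_mem hy)) _ hF2 fun y hy => by
        rw [← h0 y hy, Finset.prod_insert hxt]
        ring
      exact ((hx.2.2.2 F hF).add h2 hD.isOpen hF1 hF2).congr hD.isOpen fun y _ => by
        simp only
        ring
  refine key t ht F hF fun y hy => ?_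
  obtain ⟨x, hxt, hyx⟩ := mem_iUnion₂.1 (hcov hy)
  rw [Finset.prod_eq_zero hxt (by rw [(hbV x (ht x hxt)).2.2.1 y hyx, sub_self]), mul_zero]

/-- Near a boundary point the closure contains an open convex cone with its apex there, of slope the
Lipschitz constant, and convex sets with interior have unique derivatives. -/
theorem IsGraphChart.uniqueDiffWithinAt {U : Set (Vec d)}
    {e : Vec d ≃ₗᵢ[ℝ] WithLp 2 (Vec (d - 1) × ℝ)} {γ : Vec (d - 1) → ℝ} {K : ℝ≥0}
    (h : IsGraphChart D U e γ K) (hD : IsOpen D) {x : Vec d} (hxU : x ∈ U)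
    (hx : x ∈ frontier D) : UniqueDiffWithinAt ℝ (closure D) x := by
  obtain ⟨z, rfl⟩ := (chartEquiv e).surjective x
  have hz : γ z.1 = z.2 := (h.mem_frontier_iff hD hxU).1 hx
  -- The cone `q < 0` lies above the graph within the chart, as `γ` rises from the apex at rate at
  -- most `K`.
  let q : Vec d → ℝ := fun y => K * ‖((chartEquiv e).symm y).1 - z.1‖
    - (((chartEquiv e).symm y).2 - z.2)
  have hqc : Continuous q := by
    have h1 : Continuous fun y => ((chartEquiv e).symm y).1 :=
      continuous_fst.comp (chartEquiv e).symm.continuous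
    have h2 : Continuous fun y => ((chartEquiv e).symm y).2 :=
      continuous_snd.comp (chartEquiv e).symm.continuous
    fun_prop
  have hconv : Convex ℝ {y | q y < 0} := by
    intro y hy w hw a b ha hb hab
    simp only [mem_ofPred_eq, q, map_add, map_smul, Prod.fst_add, Prod.snd_add, Prod.smul_fst,
      Prod.smul_snd, smul_eq_mul] at hy hw ⊢
    have e1 : a • ((chartEquiv e).symm y).1 + b • ((chartEquiv e).symm w).1 - z.1
        = a • (((chartEquiv e).symm y).1 - z.1) + b • (((chartEquiv e).symm w).1 - z.1) := by
      rw [smul_sub, smul_sub, sub_add_sub_comm, ← add_smul, hab, one_smul]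
    have e2 : ‖a • (((chartEquiv e).symm y).1 - z.1) + b • (((chartEquiv e).symm w).1 - z.1)‖
        ≤ a * ‖((chartEquiv e).symm y).1 - z.1‖ + b * ‖((chartEquiv e).symm w).1 - z.1‖ := by
      refine (norm_add_le _ _).trans_eq ?_
      rw [norm_smul, norm_smul, Real.norm_of_nonneg ha, Real.norm_of_nonneg hb]
    have e3 := mul_le_mul_of_nonneg_left e2 K.coe_nonneg
    have e4 : z.2 = a * z.2 + b * z.2 := by rw [← add_mul, hab, one_mul]
    rw [e1]
    -- Strictness of the combined inequality needs a positive weight; when `a = 0` it comes from `b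
    -- = 1`.
    rcases ha.eq_or_lt with rfl | ha
    · obtain rfl : b = 1 := by linarith
      linarith
    · nlinarith
  have hopen : IsOpen {y | q y < 0} := isOpen_lt hqc continuous_const
  have hlim : Tendsto (fun s : ℝ => chartEquiv e (z.1, z.2 + s)) (𝓝[>] 0) (𝓝 (chartEquiv e z)) := by
    have hc : Continuous fun s : ℝ => chartEquiv e (z.1, z.2 + s) := by fun_prop
    have := hc.tendsto 0
    rw [add_zero] at this
    exact this.mono_left nhdsWithin_le_nhds
  have hcl : chartEquiv e z ∈ closure {y | q y < 0} := by
    refine mem_closure_of_tendsto hlim ?_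
    filter_upwards [self_mem_nhdsWithin] with s hs
    have : (0 : ℝ) < s := hs
    simpa [q] using this
  have hne : (interior {y | q y < 0}).Nonempty := by
    rw [hopen.interior_eq]
    exact closure_nonempty_iff.1 ⟨_, hcl⟩
  refine ((uniqueDiffWithinAt_convex hconv hne hcl).inter (h.isOpen.mem_nhds hxU)).mono ?_
  rintro y ⟨hy, hyU⟩
  refine subset_closure ((h.mem_iff y hyU).2 ?_)
  have h1 := h.lipschitz.dist_le_mul ((chartEquiv e).symm y).1 z.1
  rw [Real.dist_eq, dist_eq_norm, hz] at h1
  have h2 := (abs_le.1 h1).2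
  have h3 : q y < 0 := hy
  change γ ((chartEquiv e).symm y).1 < ((chartEquiv e).symm y).2
  simp only [q] at h3
  linarith

theorem IsLipschitzDomain.uniqueDiffOn_closure (hD : IsLipschitzDomain D) :
    UniqueDiffOn ℝ (closure D) := by
  intro x hx
  by_cases hxD : x ∈ D
  · exact uniqueDiffWithinAt_of_mem_nhds
      (mem_of_superset (hD.isOpen.mem_nhds hxD) subset_closure)
  · have hf : x ∈ frontier D := by
      rw [hD.isOpen.frontier_eq]
      exact ⟨hx, hxD⟩
    obtain ⟨U, e, γ, K, h, hxU⟩ := hD.exists_chart hf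
    exact h.uniqueDiffWithinAt hD.isOpen hxU hf

/-- The divergence theorem on bounded Lipschitz domains. -/
theorem IsLipschitzDomain.integral_divergence (hD : IsLipschitzDomain D) {F : Vec d → Vec d}
    (hF : ContDiffOn ℝ 1 F (closure D)) :
    IntegrableOn (divergence F) D ∧
    Integrable (fun x => inner ℝ (F x) (outwardNormal D x)) (surfaceMeasure D) ∧
    ∫ x in D, divergence F x = ∫ x, inner ℝ (F x) (outwardNormal D x) ∂(surfaceMeasure D) := by
  have hj : ∀ j, GaussFormula D fun x => F x j := fun j =>
    hD.gaussFormula (IsGaussRegular.of_contDiffOn_closure hD.isOpen hD.isBounded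
      hD.uniqueDiffOn_closure ((contDiffOn_euclidean.1 hF) j))
  have h := fun j => hj j (EuclideanSpace.single j 1)
  have hsum : ∀ x, inner ℝ (F x) (outwardNormal D x)
      = ∑ j, F x j * inner ℝ (EuclideanSpace.single j (1 : ℝ)) (outwardNormal D x) := by
    intro x
    simp [PiLp.inner_apply, mul_comm]
  simp only [hsum]
  refine ⟨integrable_finsetSum _ fun j _ => (h j).1,
    integrable_finsetSum _ fun j _ => (h j).2.1, ?_⟩
  unfold divergence
  rw [integral_finsetSum _ fun j _ => (h j).1, integral_finsetSum _ fun j _ => (h j).2.1]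
  exact Finset.sum_congr rfl fun j _ => (h j).2.2

end GlobalGauss

/-! ### Calculus in space-time up to the boundary. -/

section SpaceTime

variable {d : ℕ} {D : Set (Vec d)} {T : ℝ}
  {Y : Type*} [NormedAddCommGroup Y] [NormedSpace ℝ Y] {X : ℝ → Vec d → Y}

theorem contDiffOn_slice {n : WithTop ℕ∞}
    (hX : ContDiffOn ℝ n (fun z : ℝ × Vec d => X z.1 z.2) (Ioo 0 T ×ˢ closure D)) {t : ℝ}
    (ht : t ∈ Ioo 0 T) : ContDiffOn ℝ n (X t) (closure D) :=
  hX.comp (contDiff_prodMk_right t).contDiffOn fun _ hx => ⟨ht, hx⟩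

/-- The line `s ↦ (s, x)` stays in the space-time domain and `t` is interior to the time interval,
so the time derivative is two-sided even at boundary points of `D`. -/
theorem hasDerivAt_time
    (hX : ContDiffOn ℝ 1 (fun z : ℝ × Vec d => X z.1 z.2) (Ioo 0 T ×ˢ closure D)) {t : ℝ}
    (ht : t ∈ Ioo 0 T) {x : Vec d} (hx : x ∈ closure D) :
    HasDerivAt (fun s => X s x)
      (fderivWithin ℝ (fun z : ℝ × Vec d => X z.1 z.2) (Ioo 0 T ×ˢ closure D) (t, x) (1, 0)) t := by
  have h1 := (hX.differentiableOn one_ne_zero (t, x) ⟨ht, hx⟩).hasFDerivWithinAt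
  have h2 : HasDerivWithinAt (fun s : ℝ => (s, x)) ((1 : ℝ), (0 : Vec d)) (Ioo 0 T) t :=
    ((hasDerivAt_id t).prodMk (hasDerivAt_const t x)).hasDerivWithinAt
  have h3 := h1.comp_hasDerivWithinAt (f := fun s : ℝ => (s, x)) t h2 fun s hs => ⟨hs, hx⟩
  exact h3.hasDerivAt (Ioo_mem_nhds ht.1 ht.2)

/-- The time derivative of a field is of one class less. -/
theorem contDiffOn_deriv_time (hu : UniqueDiffOn ℝ (closure D)) {n m : WithTop ℕ∞}
    (hX : ContDiffOn ℝ n (fun z : ℝ × Vec d => X z.1 z.2) (Ioo 0 T ×ˢ closure D))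
    (hmn : m + 1 ≤ n) :
    ContDiffOn ℝ m (fun z : ℝ × Vec d => deriv (fun s => X s z.2) z.1) (Ioo 0 T ×ˢ closure D) := by
  have hS : UniqueDiffOn ℝ (Ioo 0 T ×ˢ closure D) := isOpen_Ioo.uniqueDiffOn.prod hu
  have h1 := (hX.fderivWithin hS hmn).clm_apply
    (contDiffOn_const (c := ((1 : ℝ), (0 : Vec d))))
  exact h1.congr fun z hz =>
    (hasDerivAt_time (hX.of_le (le_trans le_add_self hmn)) hz.1 hz.2).deriv

theorem gradientWithin_apply {f : Vec d → ℝ} {s : Set (Vec d)} (x : Vec d) (j : Fin d) :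
    gradientWithin f s x j = fderivWithin ℝ f s x (EuclideanSpace.single j 1) := by
  rw [← InnerProductSpace.toDual_symm_apply (𝕜 := ℝ), EuclideanSpace.inner_single_right]
  simp [gradientWithin]

/-- The spatial gradient of a scalar field is of one class less. -/
theorem contDiffOn_gradientWithin (hu : UniqueDiffOn ℝ (closure D)) {n m : WithTop ℕ∞}
    {φ : ℝ → Vec d → ℝ}
    (hφ : ContDiffOn ℝ n (fun z : ℝ × Vec d => φ z.1 z.2) (Ioo 0 T ×ˢ closure D))
    (hmn : m + 1 ≤ n) :
    ContDiffOn ℝ m (fun z : ℝ × Vec d => gradientWithin (φ z.1) (closure D) z.2)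
      (Ioo 0 T ×ˢ closure D) := by
  have hS : UniqueDiffOn ℝ (Ioo 0 T ×ˢ closure D) := isOpen_Ioo.uniqueDiffOn.prod hu
  refine contDiffOn_euclidean.2 fun j => ?_
  have h1 := (hφ.fderivWithin hS hmn).clm_apply
    (contDiffOn_const (c := ((0 : ℝ), EuclideanSpace.single j (1 : ℝ))))
  refine h1.congr fun z hz => ?_
  have hn : n ≠ 0 := fun h => by
    rw [h] at hmn
    exact one_ne_zero (le_antisymm ((le_add_self).trans hmn) (zero_le (a := (1 : WithTop ℕ∞))))
  have h2 := (hφ.differentiableOn hn z hz).hasFDerivWithinAt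
  have h3 : HasFDerivWithinAt (φ z.1) _ (closure D) z.2 :=
    HasFDerivWithinAt.comp (f := fun y : Vec d => (z.1, y)) z.2 h2
      (hasFDerivAt_prodMk_right z.1 z.2).hasFDerivWithinAt fun y hy => ⟨hz.1, hy⟩
  simp only
  rw [gradientWithin_apply, h3.fderivWithin (hu z.2 hz.2)]
  simp

theorem gradientWithin_closure_eq (hD : IsOpen D) {f : Vec d → ℝ} {x : Vec d} (hx : x ∈ D) :
    gradientWithin f (closure D) x = gradient f x := by
  rw [gradientWithin, gradient,
    fderivWithin_of_mem_nhds (mem_of_superset (hD.mem_nhds hx) subset_closure)]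

/-- Differentiation under the integral sign for fields of class `C¹` up to the boundary. -/
theorem hasDerivAt_setIntegral (hD : IsOpen D) (hDb : Bornology.IsBounded D)
    (hu : UniqueDiffOn ℝ (closure D)) {X : ℝ → Vec d → ℝ}
    (hX : ContDiffOn ℝ 1 (fun z : ℝ × Vec d => X z.1 z.2) (Ioo 0 T ×ˢ closure D)) {t : ℝ}
    (ht : t ∈ Ioo 0 T) :
    IntegrableOn (X t) D ∧
      HasDerivAt (fun s => ∫ x in D, X s x) (∫ x in D, deriv (fun s => X s x) t) t := by
  have hS : UniqueDiffOn ℝ (Ioo 0 T ×ˢ closure D) := isOpen_Ioo.uniqueDiffOn.prod hu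
  have hc : IsCompact (closure D) := hDb.isCompact_closure
  have hint : ∀ s ∈ Ioo 0 T, IntegrableOn (X s) D := fun s hs =>
    ((contDiffOn_slice hX hs).continuousOn.integrableOn_compact hc).mono_set subset_closure
  have hderiv : ContDiffOn ℝ 0 (fun z : ℝ × Vec d => deriv (fun s => X s z.2) z.1)
      (Ioo 0 T ×ˢ closure D) := contDiffOn_deriv_time hu hX (by norm_num)
  -- A compact time interval around `t` gives a compact space-time set, hence a constant dominating
  -- the time derivative.
  obtain ⟨δ, hδ, hsub⟩ := Metric.nhds_basis_closedBall.mem_iff.1 (Ioo_mem_nhds ht.1 ht.2)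
  obtain ⟨B, hB⟩ := ((isCompact_closedBall t δ).prod hc).exists_bound_of_continuousOn
    (hderiv.continuousOn.mono (prod_mono hsub le_rfl))
  refine ⟨hint t ht, (hasDerivAt_integral_of_dominated_loc_of_deriv_le
    (F' := fun s x => deriv (fun τ => X τ x) s) (bound := fun _ => B)
    (Metric.closedBall_mem_nhds t hδ) ?_ (hint t ht) ?_ ?_ ?_ ?_).2⟩
  · filter_upwards [Ioo_mem_nhds ht.1 ht.2] with s hs
    exact (hint s hs).aestronglyMeasurable
  · have h0 : ContinuousOn (fun x => deriv (fun s => X s x) t) D :=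
      (contDiffOn_slice (X := fun t x => deriv (fun s => X s x) t) hderiv ht).continuousOn.mono
        subset_closure
    exact h0.aestronglyMeasurable hD.measurableSet
  · exact (ae_restrict_iff' hD.measurableSet).2 (Eventually.of_forall fun x hx s hs =>
      hB (s, x) ⟨hs, subset_closure hx⟩)
  · exact integrableOn_const (hDb.measure_lt_top.ne)
  · refine (ae_restrict_iff' hD.measurableSet).2 (Eventually.of_forall fun x hx s hs => ?_)
    have := hasDerivAt_time hX (hsub hs) (subset_closure hx)
    rw [this.deriv]
    exact this

/-- Space and time derivatives commute. -/
theorem hasDerivAt_fderiv_slice {g : ℝ × Vec d → ℝ} {t : ℝ} {x : Vec d}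
    (hg : ContDiffAt ℝ 2 g (t, x)) (w : Vec d) :
    HasDerivAt (fun s => fderiv ℝ (fun y => g (s, y)) x w)
      (fderiv ℝ (fun y => deriv (fun s => g (s, y)) t) x w) t := by
  have hev : ∀ᶠ z in 𝓝 (t, x), DifferentiableAt ℝ g z :=
    (hg.eventually (by simp)).mono fun z hz => hz.differentiableAt two_ne_zero
  have hfd : DifferentiableAt ℝ (fderiv ℝ g) (t, x) :=
    (hg.fderiv_right (m := 1) (by norm_num)).differentiableAt one_ne_zero
  -- Both mixed derivatives are values of the second derivative of `g` in the time and space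
  -- directions, so its symmetry identifies them.
  have hsymm := (hg.isSymmSndFDerivAt (by simp)) (1, 0) (0, w)
  have hct : Tendsto (fun s : ℝ => (s, x)) (𝓝 t) (𝓝 (t, x)) :=
    (Continuous.prodMk_left x).tendsto t
  have hcx : Tendsto (fun y : Vec d => (t, y)) (𝓝 x) (𝓝 (t, x)) :=
    (Continuous.prodMk_right t).tendsto x
  have e1 : (fun s => fderiv ℝ (fun y => g (s, y)) x w)
      =ᶠ[𝓝 t] fun s => fderiv ℝ g (s, x) (0, w) := by
    filter_upwards [hct.eventually hev] with s hs
    have h : HasFDerivAt (fun y => g (s, y)) _ x :=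
      HasFDerivAt.comp (f := fun y : Vec d => (s, y)) x hs.hasFDerivAt
        (hasFDerivAt_prodMk_right s x)
    rw [h.fderiv]
    simp
  have e2 : (fun y => deriv (fun s => g (s, y)) t)
      =ᶠ[𝓝 x] fun y => fderiv ℝ g (t, y) (1, 0) := by
    filter_upwards [hcx.eventually hev] with y hy
    have h : HasDerivAt (fun s => g (s, y)) _ t :=
      HasFDerivAt.comp_hasDerivAt (f := fun s : ℝ => (s, y)) t hy.hasFDerivAt
        ((hasDerivAt_id t).prodMk (hasDerivAt_const t y))
    exact h.deriv
  have h1 : HasDerivAt (fun s => fderiv ℝ g (s, x) (0, w))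
      (fderiv ℝ (fderiv ℝ g) (t, x) (1, 0) (0, w)) t := by
    have h := HasFDerivAt.comp_hasDerivAt (f := fun s : ℝ => (s, x)) t hfd.hasFDerivAt
      ((hasDerivAt_id t).prodMk (hasDerivAt_const t x))
    simpa using h.clm_apply (hasDerivAt_const t ((0 : ℝ), w))
  have h2 : HasFDerivAt (fun y => fderiv ℝ g (t, y) (1, 0)) _ x :=
    (HasFDerivAt.comp (f := fun y : Vec d => (t, y)) x hfd.hasFDerivAt
      (hasFDerivAt_prodMk_right t x)).clm_apply (hasFDerivAt_const ((1 : ℝ), (0 : Vec d)) x)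
  rw [e2.fderiv_eq, h2.fderiv]
  refine (h1.congr_of_eventuallyEq e1).congr_deriv ?_
  rw [hsymm]
  simp

theorem laplacian_eq_divergence_gradient {f : Vec d → ℝ} {x : Vec d} (hf : ContDiffAt ℝ 2 f x) :
    Laplacian.laplacian f x = divergence (gradient f) x := by
  have hfd : DifferentiableAt ℝ (fderiv ℝ f) x :=
    (hf.fderiv_right (m := 1) (by norm_num)).differentiableAt one_ne_zero
  rw [InnerProductSpace.laplacian_eq_iteratedFDeriv_orthonormalBasis f
    (EuclideanSpace.basisFun (Fin d) ℝ)]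
  refine Finset.sum_congr rfl fun j _ => ?_
  have h1 : (fun y => gradient f y j)
      = fun y => fderiv ℝ f y (EuclideanSpace.single j 1) := by
    ext y
    rw [← gradientWithin_univ, gradientWithin_apply, fderivWithin_univ]
  rw [iteratedFDeriv_two_apply, h1,
    (hfd.hasFDerivAt.clm_apply (hasFDerivAt_const (EuclideanSpace.single j (1 : ℝ)) x)).fderiv]
  simp

theorem divergence_congr {F G : Vec d → Vec d} {x : Vec d} (h : F =ᶠ[𝓝 x] G) :
    divergence F x = divergence G x :=
  Finset.sum_congr rfl fun j _ => by
    have hj : (fun y => F y j) =ᶠ[𝓝 x] fun y => G y j := by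
      filter_upwards [h] with y hy
      rw [hy]
    rw [hj.fderiv_eq]

theorem divergence_add {F G : Vec d → Vec d} {x : Vec d} (hF : DifferentiableAt ℝ F x)
    (hG : DifferentiableAt ℝ G x) :
    divergence (fun y => F y + G y) x = divergence F x + divergence G x := by
  rw [divergence, divergence, divergence, ← Finset.sum_add_distrib]
  refine Finset.sum_congr rfl fun j _ => ?_
  simp only [PiLp.add_apply]
  rw [fderiv_fun_add (differentiableAt_euclidean.1 hF j) (differentiableAt_euclidean.1 hG j)]
  rfl

theorem divergence_const_smul {F : Vec d → Vec d} {x : Vec d} (hF : DifferentiableAt ℝ F x)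
    (c : ℝ) : divergence (fun y => c • F y) x = c * divergence F x := by
  rw [divergence, divergence, Finset.mul_sum]
  refine Finset.sum_congr rfl fun j _ => ?_
  simp only [PiLp.smul_apply]
  rw [fderiv_fun_const_smul (differentiableAt_euclidean.1 hF j)]
  rfl

theorem divergence_smul {f : Vec d → ℝ} {F : Vec d → Vec d} {x : Vec d}
    (hf : DifferentiableAt ℝ f x) (hF : DifferentiableAt ℝ F x) :
    divergence (fun y => f y • F y) x = inner ℝ (F x) (gradient f x) + f x * divergence F x := by
  have h1 : inner ℝ (F x) (gradient f x) = ∑ j, F x j * gradient f x j := by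
    rw [PiLp.inner_apply]
    exact Finset.sum_congr rfl fun j _ => mul_comm _ _
  rw [divergence, divergence, h1, Finset.mul_sum, ← Finset.sum_add_distrib]
  refine Finset.sum_congr rfl fun j _ => ?_
  simp only [PiLp.smul_apply, smul_eq_mul]
  rw [fderiv_fun_mul hf (differentiableAt_euclidean.1 hF j), ← gradientWithin_univ,
    gradientWithin_apply, fderivWithin_univ]
  simp
  ring

end SpaceTime

/-! ### The local balance law of total energy. -/

section EnergyBalance

variable {d : ℕ} {D : Set (Vec d)} {T α : ℝ} {P : ℝ → ℝ → ℝ} {Ω : Vec d → Vec (magneticDim d)}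
  {ρ : ℝ → Vec d → ℝ} {m : ℝ → Vec d → Vec d} {E : ℝ → Vec d → ℝ} {φ : ℝ → Vec d → ℝ}

/-- `∂ₜ∇φ`, up to the boundary. -/
def gradientRate (D : Set (Vec d)) (φ : ℝ → Vec d → ℝ) (t : ℝ) (x : Vec d) : Vec d :=
  deriv (fun s => gradientWithin (φ s) (closure D) x) t

theorem IsSmooth.contDiffOn_gradient (h : IsSmooth D T P ρ m E φ)
    (hu : UniqueDiffOn ℝ (closure D)) :
    ContDiffOn ℝ 2 (fun z : ℝ × Vec d => gradientWithin (φ z.1) (closure D) z.2)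
      (Ioo 0 T ×ˢ closure D) :=
  contDiffOn_gradientWithin hu h.potential (by norm_num)

/-- Of the three derivatives available for `φ`, one is spent on ∇ and one on ∂ₜ; the third is what
the divergence theorem needs of the flux. -/
theorem IsSmooth.contDiffOn_gradientRate (h : IsSmooth D T P ρ m E φ)
    (hu : UniqueDiffOn ℝ (closure D)) :
    ContDiffOn ℝ 1 (fun z : ℝ × Vec d => gradientRate D φ z.1 z.2) (Ioo 0 T ×ˢ closure D) :=
  contDiffOn_deriv_time (X := fun t x => gradientWithin (φ t) (closure D) x) hu
    (h.contDiffOn_gradient hu) (by norm_num)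

/-- `∂ₜΔφ = ∇ · ∂ₜ∇φ`. -/
theorem IsSmooth.deriv_laplacian (h : IsSmooth D T P ρ m E φ) (hD : IsOpen D)
    (hu : UniqueDiffOn ℝ (closure D)) {t : ℝ} (ht : t ∈ Ioo 0 T) {x : Vec d} (hx : x ∈ D) :
    deriv (fun s => Laplacian.laplacian (φ s) x) t = divergence (gradientRate D φ t) x := by
  have hnhds : Ioo 0 T ×ˢ closure D ∈ 𝓝 (t, x) :=
    prod_mem_nhds (Ioo_mem_nhds ht.1 ht.2) (mem_of_superset (hD.mem_nhds hx) subset_closure)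
  have hG := (h.contDiffOn_gradient hu).contDiffAt hnhds
  have hGj := fun j => contDiffAt_euclidean.1 hG j
  have e1 : (fun s => Laplacian.laplacian (φ s) x)
      =ᶠ[𝓝 t] fun s => divergence (fun y => gradientWithin (φ s) (closure D) y) x := by
    filter_upwards [Ioo_mem_nhds ht.1 ht.2] with s hs
    have h2 : ContDiffAt ℝ 2 (φ s) x := ((contDiffOn_slice h.potential hs).contDiffAt
      (mem_of_superset (hD.mem_nhds hx) subset_closure)).of_le (by norm_num)
    rw [laplacian_eq_divergence_gradient h2]
    refine divergence_congr ?_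
    filter_upwards [hD.mem_nhds hx] with y hy
    exact (gradientWithin_closure_eq hD hy).symm
  have e2 := HasDerivAt.fun_sum (u := Finset.univ) fun j _ =>
    hasDerivAt_fderiv_slice (hGj j) (EuclideanSpace.single j 1)
  rw [e1.deriv_eq]
  refine e2.deriv.trans (Finset.sum_congr rfl fun j _ => ?_)
  have e3 : (fun y => deriv (fun s => gradientWithin (φ s) (closure D) y j) t)
      =ᶠ[𝓝 x] fun y => gradientRate D φ t y j := by
    filter_upwards [hD.mem_nhds hx] with y hy
    have := hasDerivAt_time (X := fun s y => gradientWithin (φ s) (closure D) y)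
      ((h.contDiffOn_gradient hu).of_le (by norm_num)) ht (subset_closure hy)
    have h3 := ((EuclideanSpace.proj (𝕜 := ℝ) j).hasFDerivAt.comp_hasDerivAt t this).deriv
    rw [gradientRate, this.deriv]
    exact h3
  rw [e3.fderiv_eq]

theorem energyFlux_eq (D : Set (Vec d)) (t : ℝ) (x : Vec d) :
    energyFlux D α P ρ m E φ t x
      = ((ρ t x)⁻¹ * (E t x + pressure P (ρ t x) (m t x) (E t x))) • m t x
        + φ t x • (m t x + (-α⁻¹) • gradientRate D φ t x) := by
  rw [energyFlux, gradientRate, neg_smul, sub_eq_add_neg]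

/-- The part of the flux of total energy that is transported by the flow. -/
theorem IsSmooth.contDiffOn_transport (h : IsSmooth D T P ρ m E φ) {t : ℝ} (ht : t ∈ Ioo 0 T) :
    ContDiffOn ℝ 1 (fun x => ((ρ t x)⁻¹ * (E t x + MagneticEulerPoisson.pressure P (ρ t x) (m t x) (E t x))) • m t x)
      (closure D) := by
  have hp := contDiffOn_slice (X := fun t x => MagneticEulerPoisson.pressure P (ρ t x) (m t x) (E t x)) h.pressure ht
  exact (((contDiffOn_slice h.density ht).inv fun x hx => (h.density_pos t ht x hx).ne').mul
    ((contDiffOn_slice h.energy ht).add hp)).smul (contDiffOn_slice h.momentum ht)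

theorem IsSmooth.contDiffOn_energyFlux (h : IsSmooth D T P ρ m E φ)
    (hu : UniqueDiffOn ℝ (closure D)) {t : ℝ} (ht : t ∈ Ioo 0 T) :
    ContDiffOn ℝ 1 (energyFlux D α P ρ m E φ t) (closure D) := by
  have hW := contDiffOn_slice (X := gradientRate D φ) (h.contDiffOn_gradientRate hu) ht
  have hφ : ContDiffOn ℝ 1 (φ t) (closure D) :=
    (contDiffOn_slice h.potential ht).of_le (by norm_num)
  exact ((h.contDiffOn_transport ht).add (hφ.smul ((contDiffOn_slice h.momentum ht).add
    (hW.const_smul (-α⁻¹))))).congr fun x _ => energyFlux_eq D t x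

/-- The total energy density, with the gradient taken up to the boundary. -/
def energyDensityWithin (D : Set (Vec d)) (α : ℝ) (E : ℝ → Vec d → ℝ) (φ : ℝ → Vec d → ℝ)
    (t : ℝ) (x : Vec d) : ℝ :=
  E t x + 1 / (2 * α) * ‖gradientWithin (φ t) (closure D) x‖ ^ 2

/-- At boundary points `gradient` sees values of `φ` outside the closure, where nothing is assumed.
Agreement on `D` suffices for the volume integrals. -/
theorem energyDensityWithin_eqOn (hD : IsOpen D) (t : ℝ) :
    EqOn (energyDensityWithin D α E φ t) (energyDensity α E φ t) D := fun x hx => by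
  rw [energyDensityWithin, energyDensity, gradientWithin_closure_eq hD hx]

theorem IsSmooth.contDiffOn_energyDensityWithin (h : IsSmooth D T P ρ m E φ)
    (hu : UniqueDiffOn ℝ (closure D)) :
    ContDiffOn ℝ 1 (fun z : ℝ × Vec d => energyDensityWithin D α E φ z.1 z.2)
      (Ioo 0 T ×ˢ closure D) :=
  h.energy.add (contDiffOn_const.mul
    (((h.contDiffOn_gradient hu).of_le (by norm_num)).norm_sq ℝ))

/-- The local balance law of total energy. -/
theorem SolvesEquations.deriv_energyDensityWithin (hsol : SolvesEquations D T α P Ω ρ m E φ)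
    (h : IsSmooth D T P ρ m E φ) (hα : α ≠ 0) (hD : IsOpen D) (hu : UniqueDiffOn ℝ (closure D))
    {t : ℝ} (ht : t ∈ Ioo 0 T) {x : Vec d} (hx : x ∈ D) :
    deriv (fun s => energyDensityWithin D α E φ s x) t
      = -divergence (energyFlux D α P ρ m E φ t) x := by
  have hxc := subset_closure hx
  have hnhds : closure D ∈ 𝓝 x := mem_of_superset (hD.mem_nhds hx) subset_closure
  have hW := contDiffOn_slice (X := gradientRate D φ) (h.contDiffOn_gradientRate hu) ht
  have dφ : DifferentiableAt ℝ (φ t) x :=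
    ((contDiffOn_slice h.potential ht).contDiffAt hnhds).differentiableAt three_ne_zero
  have dm : DifferentiableAt ℝ (m t) x :=
    ((contDiffOn_slice h.momentum ht).contDiffAt hnhds).differentiableAt one_ne_zero
  have dW : DifferentiableAt ℝ (gradientRate D φ t) x :=
    (hW.contDiffAt hnhds).differentiableAt one_ne_zero
  have dF := ((h.contDiffOn_transport ht).contDiffAt hnhds).differentiableAt one_ne_zero
  have dW' : DifferentiableAt ℝ (fun y => (-α⁻¹) • gradientRate D φ t y) x :=
    dW.const_smul (-α⁻¹)
  have dV : DifferentiableAt ℝ (fun y => m t y + (-α⁻¹) • gradientRate D φ t y) x := dm.add dW'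
  have dφV : DifferentiableAt ℝ (fun y => φ t y • (m t y + (-α⁻¹) • gradientRate D φ t y)) x :=
    dφ.smul dV
  have hflux : divergence (energyFlux D α P ρ m E φ t) x
      = divergence (fun y =>
          ((ρ t y)⁻¹ * (E t y + pressure P (ρ t y) (m t y) (E t y))) • m t y) x
        + (inner ℝ (m t x + (-α⁻¹) • gradientRate D φ t x) (gradient (φ t) x)
          + φ t x * (divergence (m t) x + (-α⁻¹) * divergence (gradientRate D φ t) x)) := by
    rw [funext (energyFlux_eq D t), divergence_add dF dφV, divergence_smul dφ dV,
      divergence_add dm dW', divergence_const_smul dW]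
  have hpot := hsol.potential t ht x hx
  -- The potential equation takes the form ∇·∂ₜ∇φ = α∇·m, which cancels the terms of the flux
  -- divergence that carry the factor φ.
  rw [deriv.fun_neg, h.deriv_laplacian hD hu ht hx, neg_inj] at hpot
  have henergy := hsol.energy t ht x hx
  have hGt : HasDerivAt (fun s => gradientWithin (φ s) (closure D) x) (gradientRate D φ t x) t := by
    have := hasDerivAt_time (X := fun s y => gradientWithin (φ s) (closure D) y)
      ((h.contDiffOn_gradient hu).of_le (by norm_num)) ht hxc
    rw [gradientRate, this.deriv]
    exact this
  have hEt := (hasDerivAt_time h.energy ht hxc).differentiableAt.hasDerivAt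
  have hdens := (hEt.add ((hGt.norm_sq).const_mul (1 / (2 * α)))).deriv
  rw [gradientWithin_closure_eq hD hx] at hdens
  have hdens' : deriv (fun s => energyDensityWithin D α E φ s x) t
      = deriv (fun s => E s x) t
        + 1 / (2 * α) * (2 * inner ℝ (gradient (φ t) x) (gradientRate D φ t x)) := hdens
  rw [hdens', hflux, hpot, inner_add_left, inner_smul_left,
    real_inner_comm (gradient (φ t) x) (gradientRate D φ t x)]
  rw [← eq_sub_iff_add_eq] at henergy
  rw [henergy]
  simp only [conj_trivial]
  field_simp
  ring

end EnergyBalance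

end MagneticEulerPoisson

end

/-! ### The global energy balance. -/

open MagneticEulerPoisson in
theorem mainTheorem7 {d : ℕ} (hd : d = 2 ∨ d = 3) {D : Set (Vec d)} (hD : IsLipschitzDomain D)
    {T α : ℝ} (hα : 0 < α) (P : ℝ → ℝ → ℝ) (Ω : Vec d → Vec (magneticDim d))
    (ρ : ℝ → Vec d → ℝ) (m : ℝ → Vec d → Vec d) (E : ℝ → Vec d → ℝ) (φ : ℝ → Vec d → ℝ)
    (hsmooth : IsSmooth D T P ρ m E φ) (hsol : SolvesEquations D T α P Ω ρ m E φ) :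
    ∀ t ∈ Ioo 0 T,
      IntegrableOn (energyDensity α E φ t) D ∧
      Integrable (fun x => inner ℝ (energyFlux D α P ρ m E φ t x) (outwardNormal D x))
        (surfaceMeasure D) ∧
      DifferentiableAt ℝ (fun s => ∫ x in D, energyDensity α E φ s x) t ∧
      deriv (fun s => ∫ x in D, energyDensity α E φ s x) t
        + ∫ x, inner ℝ (energyFlux D α P ρ m E φ t x) (outwardNormal D x) ∂(surfaceMeasure D)
        = 0 := by
  intro t ht
  have hu := hD.uniqueDiffOn_closure
  have hDm := hD.isOpen.measurableSet
  obtain ⟨h1, h2⟩ := hasDerivAt_setIntegral hD.isOpen hD.isBounded hu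
    (hsmooth.contDiffOn_energyDensityWithin (α := α) hu) ht
  obtain ⟨-, h4, h5⟩ := hD.integral_divergence
    (hsmooth.contDiffOn_energyFlux (α := α) hu ht)
  have hfun : (fun s => ∫ x in D, energyDensityWithin D α E φ s x)
      = fun s => ∫ x in D, energyDensity α E φ s x :=
    funext fun s => setIntegral_congr_fun hDm (energyDensityWithin_eqOn hD.isOpen s)
  -- Under the integral the time derivative becomes minus the divergence of the flux, and the
  -- divergence theorem turns it into minus the boundary integral.
  rw [hfun, setIntegral_congr_fun hDm fun x hx =>
    hsol.deriv_energyDensityWithin hsmooth hα.ne' hD.isOpen hu ht hx, integral_neg, h5] at h2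
  refine ⟨h1.congr_fun (energyDensityWithin_eqOn hD.isOpen t) hDm, h4, h2.differentiableAt, ?_⟩
  rw [h2.deriv, neg_add_cancel]
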